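/- Setting. Alice holds $x\in\mathcal X$, Bob holds $y\in\mathcal Y$, and $f:\mathcal X\times\mathcal Y\to\{0,1\}$. In a one-way private-coin protocol Alice sends Bob a bit string depending on $x$ and on her random coins, and Bob outputs a bit depending on $y$ and this string; the protocol solves $f$ if it errs with probability at most $1/3$ on every input. $R^{\to}(f)$ is the least possible value of the maximum message length of such a protocol. In an online Merlin–Arthur (OMA) protocol, Merlin, who knows $(x,y)$, first sends Bob a bit string $H$; then random coins $r$ are tossed, Alice sends Bob a bit string depending on $x$ and $r$, and Bob outputs an element of $\{0,1,\bot\}$ depending on $y$, $H$, Alice's message and $r$. It solves $f$ if whenever $f(x,y)=1$ the honest Merlin's message makes Bob output $1$ with probability at least $2/3$, and whenever $f(x,y)=0$ every message of Merlin makes Bob output $1$ with probability at most $1/3$. Its hcost and vcost are the maximum lengths of the (honest) Merlin's and of Alice's message, and $\mathrm{tcost}=\mathrm{hcost}+\mathrm{vcost}$. For a family $f=(f_n)$, an $(h,v)$-OMA-protocol has $\mathrm{hcost}=O(h)$ and $\mathrm{vcost}=O(v)$, where $h,v\ge 0$ are functions of $n$; an OMA protocol (family) solving $f$ is non-trivial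 if $\mathrm{vcost}=o(R^{\to}(f))$, and the non-trivial OMA complexity $\widehat{\mathrm{MA}}^{\to}(f)$ is the least tcost of a non-trivial OMA protocol solving $f$ (a lower bound $\Omega(g)$ on it means that every non-trivial OMA protocol has tcost eventually at least $c\,g$, for one constant $c>0$). $\tilde\Omega$ hides factors polylogarithmic in the input size $\Theta(n^2)$. Statement. Alice and Bob hold graphs $G_A=(V,E_A)$ and $G_B=(V,E_B)$ on the same $n$ vertices. Let $f_n$ be either XOR-connectivity (output $1$ iff $(V,E_A\oplus E_B)$ is connected) or XOR-bipartiteness (output $1$ iff $(V,E_A\oplus E_B)$ is bipartite). Then there is a constant $c>0$ such that for all sufficiently large $n$ every OMA protocol that solves $f_n$ satisfies $$(\mathrm{hcost}+n)\cdot \mathrm{vcost}\ \ge\ c\,n^2 ;$$ in particular, every $(h,v)$-OMA-protocol solving $f$ has $(h+n)\cdot v=\Omega(n^2)$. Moreover $\widehat{\mathrm{MA}}^{\to}(f)=\Omega(n)$ and $\widehat{\mathrm{MA}}^{\to}(f)=\tilde\Omega(R^{\to}(f))$, where $R^{\to}(f)=\Omega(n)$. -/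

import Mathlib

open Filter Asymptotics
open scoped symmDiff

/-- The probability of the event `E` when `k` independent fair coins are tossed. -/
noncomputable def coinProb {k : ℕ} (E : (Fin k → Bool) → Prop) : ℝ :=
  (Nat.card {r : Fin k → Bool // E r} : ℝ) / 2 ^ k

/-- A one-way private-coin protocol: Alice sends a bit string depending on her input and on her
coin tosses; Bob answers from his input and this string alone. -/
structure OneWayProtocol (X Y : Type) where
  coins : ℕ
  msg : X → (Fin coins → Bool) → List Bool
  out : Y → List Bool → Bool

namespace OneWayProtocol

variable {X Y : Type}

/-- The protocol errs with probability at most `1/3` on every input. -/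
def Solves (P : OneWayProtocol X Y) (f : X → Y → Bool) : Prop :=
  ∀ x y, coinProb (fun r => P.out y (P.msg x r) ≠ f x y) ≤ 1 / 3

/-- The maximal length of Alice's message. -/
def cost [Fintype X] (P : OneWayProtocol X Y) : ℕ :=
  Finset.univ.sup fun p : X × (Fin P.coins → Bool) => (P.msg p.1 p.2).length

end OneWayProtocol

/-- The randomized (private-coin) one-way communication complexity of `f`. -/
noncomputable def oneWayComplexity {X Y : Type} [Fintype X] (f : X → Y → Bool) : ℕ :=
  sInf {c | ∃ P : OneWayProtocol X Y, P.Solves f ∧ P.cost = c}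

/-- An online Merlin-Arthur protocol. `help` is the strategy of the honest Merlin, who knows both
inputs but not the coins. Bob sees his input, Merlin's string, Alice's string and the coins; the
answer `none` stands for `⊥`. -/
structure OMAProtocol (X Y : Type) where
  coins : ℕ
  help : X → Y → List Bool
  msg : X → (Fin coins → Bool) → List Bool
  out : Y → List Bool → List Bool → (Fin coins → Bool) → Option Bool

namespace OMAProtocol

variable {X Y : Type}

/-- Completeness error and soundness error at most `1/3`. -/
def Solves (P : OMAProtocol X Y) (f : X → Y → Bool) : Prop :=
  (∀ x y, f x y = true →
    coinProb (fun r => P.out y (P.help x y) (P.msg x r) r ≠ some true) ≤ 1 / 3) ∧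
  (∀ x y, f x y = false → ∀ H : List Bool,
    coinProb (fun r => P.out y H (P.msg x r) r = some true) ≤ 1 / 3)

/-- Help cost: the maximal length of the honest Merlin's message. -/
def hcost [Fintype X] [Fintype Y] (P : OMAProtocol X Y) : ℕ :=
  Finset.univ.sup fun p : X × Y => (P.help p.1 p.2).length

/-- Verification cost: the maximal length of Alice's message. -/
def vcost [Fintype X] (P : OMAProtocol X Y) : ℕ :=
  Finset.univ.sup fun p : X × (Fin P.coins → Bool) => (P.msg p.1 p.2).length

/-- Total cost. -/
def tcost [Fintype X] [Fintype Y] (P : OMAProtocol X Y) : ℕ :=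
  P.hcost + P.vcost

end OMAProtocol

section Families

variable {X Y : ℕ → Type} [∀ n, Fintype (X n)] [∀ n, Fintype (Y n)]

/-- The family `P` is an `(h, v)`-OMA-protocol for the family `f`: it solves `f`, with help cost
`O(h)` and verification cost `O(v)`. -/
def IsOMAProtocolFor (f : ∀ n, X n → Y n → Bool) (P : ∀ n, OMAProtocol (X n) (Y n))
    (h v : ℕ → ℝ) : Prop :=
  (∀ n, (P n).Solves (f n)) ∧
  (fun n => ((P n).hcost : ℝ)) =O[atTop] h ∧
  (fun n => ((P n).vcost : ℝ)) =O[atTop] v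

/-- `P` is a non-trivial OMA protocol for `f`: it solves `f`, and its verification cost is
`o` of the one-way communication complexity of `f`. -/
def IsNontrivialOMA (f : ∀ n, X n → Y n → Bool) (P : ∀ n, OMAProtocol (X n) (Y n)) : Prop :=
  (∀ n, (P n).Solves (f n)) ∧
  (fun n => ((P n).vcost : ℝ)) =o[atTop] fun n => (oneWayComplexity (f n) : ℝ)

/-- The non-trivial OMA complexity of `f`, the least total cost of a non-trivial OMA protocol
for `f`, is `Ω(g)`. Non-triviality is a property of a whole family of protocols, so the minimum
is bounded below by bounding every such family, with one and the same implied constant. -/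
def NontrivialOMAComplexityOmega (f : ∀ n, X n → Y n → Bool) (g : ℕ → ℝ) : Prop :=
  ∃ c : ℝ, 0 < c ∧ ∀ P : ∀ n, OMAProtocol (X n) (Y n), IsNontrivialOMA f P →
    ∀ᶠ n in atTop, c * g n ≤ ((P n).tcost : ℝ)

/-- The same with `Ω` up to factors polylogarithmic in the input size `N n`. -/
def NontrivialOMAComplexityOmegaTilde (N : ℕ → ℕ) (f : ∀ n, X n → Y n → Bool) (g : ℕ → ℝ) :
    Prop :=
  ∃ (k : ℕ) (c : ℝ), 0 < c ∧ ∀ P : ∀ n, OMAProtocol (X n) (Y n), IsNontrivialOMA f P →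
    ∀ᶠ n in atTop, c * g n ≤ Real.logb 2 (N n) ^ k * ((P n).tcost : ℝ)

end Families

/-- A family of two-party problems in which each player holds a graph on `n` vertices. -/
abbrev GraphProblem : Type :=
  ∀ n : ℕ, SimpleGraph (Fin n) → SimpleGraph (Fin n) → Bool

open Classical in
/-- XOR-connectivity: is the symmetric difference of the two graphs connected? -/
noncomputable def xorConn : GraphProblem := fun _ A B => decide (A ∆ B).Connected

open Classical in
/-- XOR-bipartiteness: is the symmetric difference of the two graphs bipartite? -/
noncomputable def xorBip : GraphProblem := fun _ A B => decide (A ∆ B).IsBipartite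

/-! Lower bound. Alice's message does not depend on Merlin's, so one batch of `2 * k` runs can be
checked against all help strings at once: Bob accepts if some short string wins a majority. With `k`
of order `hcost + m`, the error survives a union bound over the help strings and over `m * 2 ^ m`
inputs of Bob. Alice encodes an `m × m` bit matrix, `m` about `n / 2`, as a bipartite graph, and
Bob's inputs ask whether a given row equals a given string (`Tripod.connected_iff`,
`Tripod.isBipartite_iff`). For suitable fixed coins, the messages then determine the matrix on half
of all matrices (`card_le_of_separating`), so `m ^ 2` is `O(vcost * (hcost + m))`. This forces total
cost `Ω(n)`, and a silent Merlin turns it into `Ω(n)` for one-way complexity.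

Upper bound. The comparison with one-way complexity needs a protocol of cost `n` times a
polylogarithm, which linear graph sketches provide. Borůvka's algorithm on `A ∆ B` needs, in each
phase, a few edges leaving each component. Over a field of characteristic 2, the vertex sketches of
a component sum to a sketch of its edge cut (`sum_vertexSketch`), and sketches of `A` and `B` add up
to those of `A ∆ B`. Random geometric ranks leave few edges of top rank (`unifProb_bitRank_bad_le`),
and points on the moment curve make such sparse sums decodable (`isSparseInjective_momentCurve`).
Newman's argument (`exists_seeds`) makes the random seed short enough to be sent. Bipartiteness
reduces to components through the double cover. -/

/-! ### Uniform probability on a finite type -/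

/-- The probability of the event `E` under the uniform distribution on `Ω`. -/
noncomputable def unifProb {Ω : Type*} [Fintype Ω] (E : Ω → Prop) : ℝ :=
  (Nat.card {ω // E ω} : ℝ) / Fintype.card Ω

section UnifProb

variable {Ω : Type*} [Fintype Ω]

theorem unifProb_eq (E : Ω → Prop) [DecidablePred E] :
    unifProb E = ((Finset.univ.filter E).card : ℝ) / Fintype.card Ω := by
  rw [unifProb, Nat.card_eq_fintype_card, Fintype.card_subtype]

theorem coinProb_eq_unifProb {k : ℕ} (E : (Fin k → Bool) → Prop) : coinProb E = unifProb E := by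
  simp [coinProb, unifProb]

theorem unifProb_nonneg (E : Ω → Prop) : 0 ≤ unifProb E := by
  unfold unifProb; positivity

theorem unifProb_mono {E E' : Ω → Prop} (h : ∀ ω, E ω → E' ω) : unifProb E ≤ unifProb E' := by
  classical
  rw [unifProb_eq, unifProb_eq]
  gcongr with ω
  exact h ω

theorem unifProb_eq_zero {E : Ω → Prop} (h : ∀ ω, ¬ E ω) : unifProb E = 0 := by
  classical
  rw [unifProb_eq, Finset.filter_eq_empty_iff.mpr fun ω _ => h ω]
  simp

theorem unifProb_true [Nonempty Ω] {E : Ω → Prop} (h : ∀ ω, E ω) : unifProb E = 1 := by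
  classical
  rw [unifProb_eq, Finset.filter_true_of_mem fun ω _ => h ω, Finset.card_univ, div_self]
  exact_mod_cast Fintype.card_ne_zero

theorem exists_not_of_unifProb_lt_one [Nonempty Ω] {E : Ω → Prop} (h : unifProb E < 1) :
    ∃ ω, ¬ E ω := by
  by_contra! hc
  exact h.ne (unifProb_true hc)

theorem unifProb_exists_le {ι : Type*} [Fintype ι] (E : ι → Ω → Prop) :
    unifProb (fun ω => ∃ i, E i ω) ≤ ∑ i, unifProb (E i) := by
  classical
  simp only [unifProb_eq]
  rw [← Finset.sum_div]
  gcongr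
  have : (Finset.univ.filter fun ω => ∃ i, E i ω) =
      Finset.univ.biUnion fun i => Finset.univ.filter (E i) := by
    ext; simp
  rw [this]
  exact_mod_cast Finset.card_biUnion_le

theorem unifProb_exists_le_card_mul {ι : Type*} [Fintype ι] (E : ι → Ω → Prop) {ε : ℝ}
    (h : ∀ i, unifProb (E i) ≤ ε) :
    unifProb (fun ω => ∃ i, E i ω) ≤ Fintype.card ι * ε := by
  refine (unifProb_exists_le E).trans ((Finset.sum_le_sum fun i _ => h i).trans ?_)
  simp

theorem unifProb_or_le (E E' : Ω → Prop) :
    unifProb (fun ω => E ω ∨ E' ω) ≤ unifProb E + unifProb E' := by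
  classical
  simp only [unifProb_eq]
  rw [← add_div, Finset.filter_or]
  gcongr
  exact_mod_cast Finset.card_union_le _ _

/-- Fubini for one coordinate: an event that has probability at most `ε` when a single coordinate
is resampled has probability at most `ε`. -/
theorem unifProb_le_of_update {ι β : Type*} [Fintype ι] [DecidableEq ι] [Fintype β] [Nonempty β]
    (E : (ι → β) → Prop) (i : ι) {ε : ℝ}
    (h : ∀ ω, unifProb (fun b => E (Function.update ω i b)) ≤ ε) : unifProb E ≤ ε := by
  classical
  have hβ : (0 : ℝ) < Fintype.card β := by exact_mod_cast Fintype.card_pos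
  have hΩ : (0 : ℝ) < Fintype.card (ι → β) := by exact_mod_cast Fintype.card_pos
  -- Exchanging the resampled value with the old one is an involution on pairs, so summing over
  -- updated points is the same as summing over the original ones.
  let σ : (ι → β) × β → (ι → β) × β := fun p => (Function.update p.1 i p.2, p.1 i)
  have hσ : Function.Involutive σ := by
    rintro ⟨ω, b⟩
    simp [σ]
  have key : ∑ ω : ι → β, ∑ b : β, (if E (Function.update ω i b) then (1 : ℝ) else 0) =
      ∑ ω : ι → β, ∑ _b : β, (if E ω then (1 : ℝ) else 0) := by
    rw [← Fintype.sum_prod_type', ← Fintype.sum_prod_type']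
    exact Fintype.sum_equiv hσ.toPerm _ _ fun p => rfl
  have h1 : ∀ ω : ι → β, ∑ b : β, (if E (Function.update ω i b) then (1 : ℝ) else 0) ≤
      ε * Fintype.card β := by
    intro ω
    have := h ω
    rw [unifProb_eq, div_le_iff₀ hβ] at this
    simpa [Finset.sum_boole] using this
  have h2 := (Finset.sum_le_sum fun ω (_ : ω ∈ Finset.univ) => h1 ω)
  rw [key] at h2
  simp only [Finset.sum_const, Finset.card_univ, nsmul_eq_mul, ← Finset.mul_sum,
    Finset.sum_boole] at h2
  rw [unifProb_eq, div_le_iff₀ hΩ]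
  nlinarith

theorem unifProb_forall_mem_eq_le {κ : Type*} [Fintype κ] [DecidableEq κ] (S : Finset κ)
    (c : Bool) :
    unifProb (fun b : κ → Bool => ∀ e ∈ S, b e = c) ≤ (1 / 2) ^ S.card := by
  classical
  have hset : (Finset.univ.filter fun b : κ → Bool => ∀ e ∈ S, b e = c) =
      Fintype.piFinset fun e => if e ∈ S then {c} else Finset.univ := by
    ext b
    simp only [Finset.mem_filter, Finset.mem_univ, true_and, Fintype.mem_piFinset]
    refine forall_congr' fun e => ?_
    by_cases he : e ∈ S <;> simp [he]
  have hcard : (Finset.univ.filter fun b : κ → Bool => ∀ e ∈ S, b e = c).card * 2 ^ S.card =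
      Fintype.card (κ → Bool) := by
    rw [hset, Fintype.card_piFinset]
    have h1 : (2 : ℕ) ^ S.card = ∏ e : κ, if e ∈ S then 2 else 1 := by
      rw [Finset.prod_ite_mem]; simp
    rw [h1, ← Finset.prod_mul_distrib]
    have : ∀ e : κ, ((if e ∈ S then ({c} : Finset Bool) else Finset.univ).card *
        if e ∈ S then 2 else 1) = 2 := by
      intro e
      by_cases he : e ∈ S <;> simp [he]
    rw [Finset.prod_congr rfl fun e _ => this e]
    simp
  rw [unifProb_eq, ← hcard, div_le_iff₀ (by rw [hcard]; exact_mod_cast Fintype.card_pos)]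
  push_cast
  rw [mul_left_comm, ← mul_pow]
  norm_num

theorem unifProb_forall_le {ι : Type*} [Fintype ι] [DecidableEq ι] [Nonempty Ω] (p : Ω → Prop) :
    unifProb (fun ω : ι → Ω => ∀ i, p (ω i)) ≤ unifProb p ^ Fintype.card ι := by
  classical
  have hset : (Finset.univ.filter fun ω : ι → Ω => ∀ i, p (ω i)) =
      Fintype.piFinset fun _ => Finset.univ.filter p := by
    ext; simp
  rw [unifProb_eq, unifProb_eq, hset, Fintype.card_piFinset, div_pow]
  simp

/-- A Chernoff bound: among independent samples, many fall into a rare event only with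
exponentially small probability. -/
theorem unifProb_card_ge_le {ι : Type*} [Fintype ι] [DecidableEq ι] [Nonempty Ω] (E : Ω → Prop)
    [DecidablePred E] (a : ℕ) {ε : ℝ}
    (h : unifProb E ≤ ε) :
    unifProb (fun ω : ι → Ω => a ≤ (Finset.univ.filter fun i => E (ω i)).card) ≤
      (1 + ε) ^ Fintype.card ι / 2 ^ a := by
  have hΩ : (0 : ℝ) < Fintype.card Ω := by exact_mod_cast Fintype.card_pos
  have hsum : ∑ ω : Ω, (if E ω then (2 : ℝ) else 1) ≤ (1 + ε) * Fintype.card Ω := by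
    have : ∀ ω : Ω, (if E ω then (2 : ℝ) else 1) = 1 + if E ω then 1 else 0 := by
      intro ω; split_ifs <;> norm_num
    simp only [this, Finset.sum_add_distrib, Finset.sum_boole]
    rw [unifProb_eq, div_le_iff₀ hΩ] at h
    simp
    linarith
  -- The exponential moment with base 2 factorizes over the independent samples; `hmk` is then
  -- Markov's inequality.
  have hprod : ∑ ω : ι → Ω, (2 : ℝ) ^ (Finset.univ.filter fun i => E (ω i)).card =
      (∑ ω : Ω, (if E ω then (2 : ℝ) else 1)) ^ Fintype.card ι := by
    rw [← Finset.card_univ, ← Finset.prod_const, Finset.prod_univ_sum, Fintype.piFinset_univ]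
    refine Finset.sum_congr rfl fun ω _ => ?_
    rw [Finset.prod_ite]
    simp
  have hmk : ((Finset.univ.filter fun ω : ι → Ω =>
      a ≤ (Finset.univ.filter fun i => E (ω i)).card).card : ℝ) * 2 ^ a ≤
      ∑ ω : ι → Ω, (2 : ℝ) ^ (Finset.univ.filter fun i => E (ω i)).card := by
    rw [← nsmul_eq_mul]
    refine (Finset.card_nsmul_le_sum _ _ _ fun ω hω => ?_).trans
      (Finset.sum_le_sum_of_subset_of_nonneg (Finset.filter_subset _ _) fun _ _ _ => by positivity)
    exact pow_le_pow_right₀ (by norm_num) (Finset.mem_filter.mp hω).2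
  have hfin : ((Finset.univ.filter fun ω : ι → Ω =>
      a ≤ (Finset.univ.filter fun i => E (ω i)).card).card : ℝ) * 2 ^ a ≤
      (1 + ε) ^ Fintype.card ι * Fintype.card (ι → Ω) := by
    refine hmk.trans ?_
    rw [hprod]
    refine (pow_le_pow_left₀ (Finset.sum_nonneg fun ω _ => by split_ifs <;> norm_num) hsum _).trans
      (le_of_eq ?_)
    rw [mul_pow]; simp
  have hΩ' : (0 : ℝ) < Fintype.card (ι → Ω) := by exact_mod_cast Fintype.card_pos
  rw [unifProb_eq, div_le_div_iff₀ hΩ' (by positivity)]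
  exact hfin

/-- If every element of `A` fails on at most half of the sample space, then some sample works for
at least half of `A`. -/
theorem exists_card_le_two_mul_card_filter {A : Type*} [Fintype A] [Nonempty Ω]
    (Good : A → Ω → Prop) [∀ ω, DecidablePred fun a => Good a ω]
    (h : ∀ a, unifProb (fun ω => ¬ Good a ω) ≤ 1 / 2) :
    ∃ ω, Fintype.card A ≤ 2 * (Finset.univ.filter fun a => Good a ω).card := by
  classical
  by_contra! hc
  have hΩ : (0 : ℝ) < Fintype.card Ω := by exact_mod_cast Fintype.card_pos
  have h1 : ∀ a, (Fintype.card Ω : ℝ) ≤ 2 * ∑ ω : Ω, if Good a ω then (1 : ℝ) else 0 := by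
    intro a
    have := h a
    rw [unifProb_eq, div_le_iff₀ hΩ] at this
    have h2 := Finset.card_filter_add_card_filter_not (s := (Finset.univ : Finset Ω)) (Good a)
    rw [Finset.card_univ] at h2
    have h3 : ((Finset.univ.filter (Good a)).card : ℝ) +
      ((Finset.univ.filter fun ω => ¬ Good a ω).card : ℝ) = Fintype.card Ω := by exact_mod_cast h2
    rw [Finset.sum_boole]
    have h4 : (Fintype.card Ω : ℝ) ≤ 2 * (Finset.univ.filter (Good a)).card := by linarith
    convert h4
  have h2 : ∀ ω, 2 * (∑ a : A, if Good a ω then (1 : ℝ) else 0) < Fintype.card A := by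
    intro ω
    rw [Finset.sum_boole]
    exact_mod_cast hc ω
  have h3 := Finset.sum_le_sum fun a (_ : a ∈ Finset.univ) => h1 a
  have h4 := Finset.sum_lt_sum_of_nonempty Finset.univ_nonempty
    fun ω (_ : ω ∈ (Finset.univ : Finset Ω)) => h2 ω
  rw [← Finset.mul_sum] at h3 h4
  rw [Finset.sum_comm] at h3
  simp only [Finset.sum_const, Finset.card_univ, nsmul_eq_mul] at h3 h4
  nlinarith

end UnifProb

/-! ### Counting bit strings -/

/-- There are at most `4 ^ v` bit strings of length at most `v`. -/
theorem ncard_length_le (v : ℕ) :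
    {l : List Bool | l.length ≤ v}.Finite ∧ {l : List Bool | l.length ≤ v}.ncard ≤ 4 ^ v := by
  refine ⟨List.finite_length_le Bool v, ?_⟩
  induction v with
  | zero =>
    simp
  | succ v ih =>
    have hsub : {l : List Bool | l.length ≤ v + 1} ⊆
        insert [] ((fun p : Bool × List Bool => p.1 :: p.2) ''
          ((Set.univ : Set Bool) ×ˢ {l : List Bool | l.length ≤ v})) := by
      rintro (_ | ⟨b, l⟩) hl
      · simp
      · right
        exact ⟨(b, l), ⟨trivial, by simpa using hl⟩, rfl⟩
    have hfin := List.finite_length_le Bool v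
    have hfin' : ((Set.univ : Set Bool) ×ˢ {l : List Bool | l.length ≤ v}).Finite :=
      Set.finite_univ.prod hfin
    refine (Set.ncard_le_ncard hsub ((hfin'.image _).insert _)).trans ?_
    refine (Set.ncard_insert_le _ _).trans ?_
    have h1 := Set.ncard_image_le hfin' (f := fun p : Bool × List Bool => p.1 :: p.2)
    rw [Set.ncard_prod] at h1
    have h2 : (Set.univ : Set Bool).ncard = 2 := by simp
    rw [h2] at h1
    have : 1 ≤ 4 ^ v := Nat.one_le_pow _ _ (by norm_num)
    rw [pow_succ]
    omega

/-! ### Repeating an online Merlin-Arthur protocol -/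

namespace OMAProtocol

variable {X Y : Type}

theorem length_help_le_hcost [Fintype X] [Fintype Y] (P : OMAProtocol X Y) (x : X) (y : Y) :
    (P.help x y).length ≤ P.hcost :=
  Finset.le_sup (f := fun p : X × Y => (P.help p.1 p.2).length) (Finset.mem_univ (x, y))

theorem length_msg_le_vcost [Fintype X] (P : OMAProtocol X Y) (x : X)
    (r : Fin P.coins → Bool) : (P.msg x r).length ≤ P.vcost :=
  Finset.le_sup (f := fun p : X × (Fin P.coins → Bool) => (P.msg p.1 p.2).length)
    (Finset.mem_univ (x, r))

/-- Bob's decision after `2 * k` independent runs of the verification: some short help string is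
accepted by a majority of the runs. -/
def MajorityAccepts [Fintype X] [Fintype Y] (P : OMAProtocol X Y) {k : ℕ} (y : Y)
    (a : Fin (2 * k) → List Bool) (r : Fin (2 * k) → Fin P.coins → Bool) : Prop :=
  ∃ H : List Bool, H.length ≤ P.hcost ∧
    k < (Finset.univ.filter fun i => P.out y H (a i) (r i) = some true).card

/-- The Chernoff bound at error `1 / 3` gives `(4 / 3) ^ (2 * k) / 2 ^ k = (8 / 9) ^ k` for one help
string. On 1-inputs the honest string suffices; on 0-inputs a union bound over the short strings
costs `4 ^ hcost`. -/
theorem unifProb_majorityAccepts_wrong_le [Fintype X] [Fintype Y] (P : OMAProtocol X Y)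
    {f : X → Y → Bool} (hP : P.Solves f) (k : ℕ) (x : X) (y : Y) :
    unifProb (fun r : Fin (2 * k) → Fin P.coins → Bool =>
      ¬ (P.MajorityAccepts y (fun i => P.msg x (r i)) r ↔ f x y = true)) ≤
      4 ^ P.hcost * (8 / 9) ^ k := by
  classical
  have hδ : ((1 : ℝ) + 1 / 3) ^ Fintype.card (Fin (2 * k)) / 2 ^ k = (8 / 9) ^ k := by
    rw [Fintype.card_fin, pow_mul, ← div_pow]
    norm_num
  cases hf : f x y with
  | true =>
    have h1 := hP.1 x y hf
    rw [coinProb_eq_unifProb] at h1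
    have h2 := unifProb_card_ge_le (ι := Fin (2 * k)) _ k h1
    rw [hδ] at h2
    refine (unifProb_mono ?_).trans (h2.trans (le_mul_of_one_le_left (by positivity)
      (one_le_pow₀ (by norm_num))))
    intro r hr
    by_contra! hc
    apply hr
    simp only [iff_true]
    refine ⟨P.help x y, P.length_help_le_hcost x y, ?_⟩
    have h3 := Finset.card_filter_add_card_filter_not (s := (Finset.univ : Finset (Fin (2 * k))))
      (fun i => P.out y (P.help x y) (P.msg x (r i)) (r i) = some true)
    rw [Finset.card_univ, Fintype.card_fin] at h3
    have h4 : (Finset.univ.filter fun i => ¬ P.out y (P.help x y) (P.msg x (r i)) (r i) =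
      some true).card < k := hc
    beta_reduce
    omega
  | false =>
    have hfin := (ncard_length_le P.hcost).1
    have hcard := (ncard_length_le P.hcost).2
    let S := {l : List Bool | l.length ≤ P.hcost}
    have : Fintype S := hfin.fintype
    have h1 : ∀ H : S, unifProb (fun r : Fin (2 * k) → Fin P.coins → Bool =>
        k ≤ (Finset.univ.filter fun i => P.out y H (P.msg x (r i)) (r i) = some true).card) ≤
        (8 / 9) ^ k := by
      intro H
      have h2 := hP.2 x y hf H
      rw [coinProb_eq_unifProb] at h2
      have h3 := unifProb_card_ge_le (ι := Fin (2 * k)) _ k h2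
      rw [hδ] at h3
      exact h3
    have h4 := unifProb_exists_le_card_mul _ h1
    have h5 : (Fintype.card S : ℝ) ≤ 4 ^ P.hcost := by
      rw [← Nat.card_eq_fintype_card, Nat.card_coe_set_eq]
      exact_mod_cast hcard
    refine (unifProb_mono ?_).trans (h4.trans (by gcongr))
    intro r hr
    simp only [Bool.false_eq_true, iff_false, not_not] at hr
    obtain ⟨H, hH, hk⟩ := hr
    refine ⟨⟨H, hH⟩, ?_⟩
    exact hk.le

/-- If Bob can choose among the inputs `ψ y` to tell apart all of Alice's inputs `φ x`, then
repeating a protocol often enough to afford a union bound over all `ψ y` makes Alice's messages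
an encoding of `x`. -/
theorem card_le_of_separating [Fintype X] [Fintype Y] (P : OMAProtocol X Y)
    {f : X → Y → Bool} (hP : P.Solves f) {A B : Type} [Fintype A] [Fintype B]
    (φ : A → X) (ψ : B → Y)
    (hsep : ∀ a a', (∀ b, f (φ a) (ψ b) = f (φ a') (ψ b)) → a = a') (k : ℕ)
    (hk : (Fintype.card B : ℝ) * (4 ^ P.hcost * (8 / 9) ^ k) ≤ 1 / 2) :
    Fintype.card A ≤ 2 * 4 ^ (P.vcost * (2 * k)) := by
  classical
  let R := Fin (2 * k) → Fin P.coins → Bool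
  let Good : A → R → Prop := fun a r => ∀ b,
    P.MajorityAccepts (ψ b) (fun i => P.msg (φ a) (r i)) r ↔ f (φ a) (ψ b) = true
  have hgood : ∀ a, unifProb (fun r => ¬ Good a r) ≤ 1 / 2 := by
    intro a
    refine le_trans ?_ hk
    have := unifProb_exists_le_card_mul _
      (fun b => P.unifProb_majorityAccepts_wrong_le hP k (φ a) (ψ b))
    refine (unifProb_mono ?_).trans this
    intro r hr
    simpa [Good] using hr
  -- Fixing the coins loses at most half of `A`; this is the factor 2 in the conclusion.
  obtain ⟨r, hr⟩ := exists_card_le_two_mul_card_filter Good hgood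
  refine hr.trans (Nat.mul_le_mul_left _ ?_)
  have hfin := (ncard_length_le P.vcost).1
  have hcard := (ncard_length_le P.vcost).2
  have h1 : (Fintype.piFinset fun _ : Fin (2 * k) => hfin.toFinset).card ≤
      4 ^ (P.vcost * (2 * k)) := by
    rw [Fintype.card_piFinset, Finset.prod_const, Finset.card_univ, Fintype.card_fin, pow_mul _ P.vcost,
      ← Set.ncard_eq_toFinset_card _ hfin]
    exact Nat.pow_le_pow_left hcard _
  refine le_trans ?_ h1
  refine Finset.card_le_card_of_injOn (fun a i => P.msg (φ a) (r i)) ?_ ?_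
  · intro a _
    simp [length_msg_le_vcost]
  · intro a ha a' ha' heq
    have ha := (Finset.mem_filter.mp ha).2
    have ha' := (Finset.mem_filter.mp ha').2
    refine hsep a a' fun b => ?_
    have h2 := ha b
    have h3 := ha' b
    simp only [] at heq
    rw [heq] at h2
    rw [Bool.eq_iff_iff, ← h2, ← h3]

end OMAProtocol

/-! ### Graph inputs that force Alice to reveal a bipartite graph -/

theorem SimpleGraph.symmDiff_adj_iff {V : Type*} (G H : SimpleGraph V) (u v : V) :
    (G ∆ H).Adj u v ↔ ¬ (G.Adj u v ↔ H.Adj u v) := by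
  simp only [symmDiff_def, SimpleGraph.sup_adj, SimpleGraph.sdiff_adj]
  tauto

/-- Disjoint vertex families `left` and `right` and a further vertex `apex`. -/
structure Tripod (V : Type) (m : ℕ) where
  apex : V
  left : Fin m → V
  right : Fin m → V
  left_injective : Function.Injective left
  right_injective : Function.Injective right
  left_ne_right : ∀ i j, left i ≠ right j
  apex_ne_left : ∀ i, apex ≠ left i
  apex_ne_right : ∀ i, apex ≠ right i

namespace Tripod

variable {V : Type} {m : ℕ} (t : Tripod V m)

/-- The bipartite graph between `left` and `right` described by the matrix `b`. -/
def aliceGraph (b : Fin m → Fin m → Bool) : SimpleGraph V :=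
  SimpleGraph.fromRel fun u v => ∃ i j, b i j = true ∧ u = t.left i ∧ v = t.right j

/-- Bob's graph for testing with connectivity whether `left i` has neighbourhood `N`. -/
def connGraph (q : Fin m × (Fin m → Bool)) : SimpleGraph V :=
  SimpleGraph.fromRel fun u v => (u = t.apex ∧ v ≠ t.left q.1) ∨
    (u = t.left q.1 ∧ ∃ j, q.2 j = true ∧ v = t.right j)

/-- Bob's graph for testing with bipartiteness whether `left i` has neighbourhood `N`. -/
def bipGraph (q : Fin m × (Fin m → Bool)) : SimpleGraph V :=
  SimpleGraph.fromRel fun u v => (u = t.apex ∧ (v = t.left q.1 ∨ ∃ j, v = t.right j)) ∨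
    (u = t.left q.1 ∧ ∃ j, q.2 j = true ∧ v = t.right j)

theorem not_aliceGraph_adj_apex (b : Fin m → Fin m → Bool) (v : V) :
    ¬ (t.aliceGraph b).Adj t.apex v := by
  rintro ⟨-, ⟨i, j, -, h, -⟩ | ⟨i, j, -, -, h⟩⟩
  · exact t.apex_ne_left _ h
  · exact t.apex_ne_right _ h

theorem aliceGraph_adj_left (b : Fin m → Fin m → Bool) (i : Fin m) (v : V) :
    (t.aliceGraph b).Adj (t.left i) v ↔ ∃ j, b i j = true ∧ v = t.right j := by
  constructor
  · rintro ⟨-, ⟨i', j, hb, h, hv⟩ | ⟨i', j, -, -, h⟩⟩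
    · rw [t.left_injective h]
      exact ⟨j, hb, hv⟩
    · exact absurd h (t.left_ne_right _ _)
  · rintro ⟨j, hb, rfl⟩
    exact ⟨t.left_ne_right _ _, Or.inl ⟨i, j, hb, rfl, rfl⟩⟩

theorem connGraph_adj_left (i : Fin m) (N : Fin m → Bool) (v : V) :
    (t.connGraph (i, N)).Adj (t.left i) v ↔ ∃ j, N j = true ∧ v = t.right j := by
  constructor
  · rintro ⟨-, (⟨h, -⟩ | ⟨-, h⟩) | (⟨-, h⟩ | ⟨h, j, hj, h'⟩)⟩
    · exact absurd h.symm (t.apex_ne_left _)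
    · exact h
    · exact absurd rfl h
    · exact absurd h' (t.left_ne_right _ _)
  · rintro ⟨j, hb, rfl⟩
    exact ⟨t.left_ne_right _ _, Or.inl (Or.inr ⟨rfl, j, hb, rfl⟩)⟩

theorem bipGraph_adj_left (i : Fin m) (N : Fin m → Bool) (v : V) :
    (t.bipGraph (i, N)).Adj (t.left i) v ↔ v = t.apex ∨ ∃ j, N j = true ∧ v = t.right j := by
  constructor
  · rintro ⟨-, (⟨h, -⟩ | ⟨-, h⟩) | (⟨h, -⟩ | ⟨h, j, hj, h'⟩)⟩
    · exact absurd h.symm (t.apex_ne_left _)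
    · exact Or.inr h
    · exact Or.inl h
    · exact absurd h' (t.left_ne_right _ _)
  · rintro (rfl | ⟨j, hb, rfl⟩)
    · exact ⟨(t.apex_ne_left _).symm, Or.inr (Or.inl ⟨rfl, Or.inl rfl⟩)⟩
    · exact ⟨t.left_ne_right _ _, Or.inl (Or.inr ⟨rfl, j, hb, rfl⟩)⟩

/-- Bob's star at `apex` reaches every vertex but `left i` and meets no edge of Alice. So
connectivity hinges on whether `left i` keeps a neighbour, that is, on whether the rows `N` and `b
i` differ somewhere. -/
theorem connected_iff (b : Fin m → Fin m → Bool) (i : Fin m) (N : Fin m → Bool) :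
    (t.aliceGraph b ∆ t.connGraph (i, N)).Connected ↔ N ≠ b i := by
  constructor
  · rintro h rfl
    obtain ⟨p⟩ := h.preconnected (t.left i) t.apex
    have hadj := p.adj_snd (p.not_nil_of_ne (t.apex_ne_left i).symm)
    rw [SimpleGraph.symmDiff_adj_iff, aliceGraph_adj_left, connGraph_adj_left] at hadj
    exact hadj Iff.rfl
  · intro h
    obtain ⟨j, hj⟩ := Function.ne_iff.mp h
    have hadj : (t.aliceGraph b ∆ t.connGraph (i, N)).Adj (t.left i) (t.right j) := by
      rw [SimpleGraph.symmDiff_adj_iff, aliceGraph_adj_left, connGraph_adj_left]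
      simp only [t.right_injective.eq_iff, exists_eq_right']
      exact fun h' => hj (Bool.eq_iff_iff.mpr h').symm
    have hreach : ∀ v, v ≠ t.left i →
        (t.aliceGraph b ∆ t.connGraph (i, N)).Reachable t.apex v := by
      intro v hv
      by_cases hw : t.apex = v
      · rw [hw]
      · apply SimpleGraph.Adj.reachable
        rw [SimpleGraph.symmDiff_adj_iff]
        intro h'
        exact t.not_aliceGraph_adj_apex b v (h'.mpr ⟨hw, Or.inl (Or.inl ⟨rfl, hv⟩)⟩)
    have hreach' : ∀ v, (t.aliceGraph b ∆ t.connGraph (i, N)).Reachable t.apex v := by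
      intro v
      by_cases hv : v = t.left i
      · rw [hv]
        exact (hreach _ (t.left_ne_right i j).symm).trans hadj.symm.reachable
      · exact hreach v hv
    have : Nonempty V := ⟨t.apex⟩
    exact ⟨fun u v => (hreach' u).symm.trans (hreach' v)⟩

/-- A position where the rows differ closes a triangle `apex`, `left i`, `right j`. If they agree,
`left i` is a leaf at `apex`, and every other edge joins the `right` vertices to the rest. -/
theorem isBipartite_iff (b : Fin m → Fin m → Bool) (i : Fin m) (N : Fin m → Bool) :
    (t.aliceGraph b ∆ t.bipGraph (i, N)).IsBipartite ↔ N = b i := by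
  classical
  constructor
  · rintro ⟨c⟩
    by_contra h
    obtain ⟨j, hj⟩ := Function.ne_iff.mp h
    have h1 : (t.aliceGraph b ∆ t.bipGraph (i, N)).Adj (t.left i) (t.right j) := by
      rw [SimpleGraph.symmDiff_adj_iff, aliceGraph_adj_left, bipGraph_adj_left]
      simp only [t.right_injective.eq_iff, exists_eq_right', (t.apex_ne_right j).symm, false_or]
      exact fun h' => hj (Bool.eq_iff_iff.mpr h').symm
    have h2 : (t.aliceGraph b ∆ t.bipGraph (i, N)).Adj t.apex (t.left i) := by
      rw [SimpleGraph.symmDiff_adj_iff]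
      intro h'
      exact t.not_aliceGraph_adj_apex b _
        (h'.mpr ⟨t.apex_ne_left i, Or.inl (Or.inl ⟨rfl, Or.inl rfl⟩)⟩)
    have h3 : (t.aliceGraph b ∆ t.bipGraph (i, N)).Adj t.apex (t.right j) := by
      rw [SimpleGraph.symmDiff_adj_iff]
      intro h'
      exact t.not_aliceGraph_adj_apex b _
        (h'.mpr ⟨t.apex_ne_right j, Or.inl (Or.inl ⟨rfl, Or.inr ⟨j, rfl⟩⟩)⟩)
    have h1 := c.valid h1
    have h2 := c.valid h2
    have h3 := c.valid h3
    omega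
  · rintro rfl
    refine ⟨SimpleGraph.Coloring.mk
      (fun v => if v = t.left i ∨ ∃ j, v = t.right j then (1 : Fin 2) else 0) ?_⟩
    have hleft : ∀ v, (t.aliceGraph b ∆ t.bipGraph (i, b i)).Adj (t.left i) v ↔ v = t.apex := by
      intro v
      rw [SimpleGraph.symmDiff_adj_iff, aliceGraph_adj_left, bipGraph_adj_left]
      constructor
      · intro h
        by_contra hv
        exact h ⟨Or.inr, fun h' => h'.resolve_left hv⟩
      · rintro rfl h
        obtain ⟨j, -, hj⟩ := h.mpr (Or.inl rfl)
        exact t.apex_ne_right _ hj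
    have hside : ∀ u v, u ≠ t.left i → v ≠ t.left i →
        (t.aliceGraph b ∆ t.bipGraph (i, b i)).Adj u v →
        ((∃ j, u = t.right j) ∧ ∀ j, v ≠ t.right j) ∨
        ((∃ j, v = t.right j) ∧ ∀ j, u ≠ t.right j) := by
      intro u v hu hv hadj
      rw [SimpleGraph.symmDiff_adj_iff] at hadj
      have : (t.aliceGraph b).Adj u v ∨ (t.bipGraph (i, b i)).Adj u v := by tauto
      rcases this with ⟨-, ⟨i', j, -, rfl, rfl⟩ | ⟨i', j, -, rfl, rfl⟩⟩ |
        ⟨-, (⟨rfl, h | ⟨j, rfl⟩⟩ | ⟨h, -⟩) | (⟨rfl, h | ⟨j, rfl⟩⟩ | ⟨h, -⟩)⟩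
      · exact Or.inr ⟨⟨j, rfl⟩, fun _ => t.left_ne_right _ _⟩
      · exact Or.inl ⟨⟨j, rfl⟩, fun _ => t.left_ne_right _ _⟩
      · exact absurd h hv
      · exact Or.inr ⟨⟨j, rfl⟩, fun _ => t.apex_ne_right _⟩
      · exact absurd h hu
      · exact absurd h hu
      · exact Or.inl ⟨⟨j, rfl⟩, fun _ => t.apex_ne_right _⟩
      · exact absurd h hv
    intro u v hadj
    have hapex : ¬ (t.apex = t.left i ∨ ∃ j, t.apex = t.right j) := by
      rintro (h | ⟨j, h⟩)
      · exact t.apex_ne_left _ h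
      · exact t.apex_ne_right _ h
    by_cases hu : u = t.left i
    · subst hu
      rw [hleft] at hadj
      subst hadj
      simp [hapex]
    · by_cases hv : v = t.left i
      · subst hv
        have hadj := hadj.symm
        rw [hleft] at hadj
        subst hadj
        simp [hapex]
      · rcases hside u v hu hv hadj with ⟨h1, h2⟩ | ⟨h1, h2⟩
        · simp [h1, h2, hv]
        · simp [h1, h2, hu]

end Tripod

/-- Such families exist in `Fin n` for `2 * m < n`. -/
def finTripod {n m : ℕ} (h : 2 * m < n) : Tripod (Fin n) m where
  apex := ⟨0, by omega⟩
  left i := ⟨1 + i, by omega⟩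
  right i := ⟨1 + m + i, by omega⟩
  left_injective i j h := by simp [Fin.ext_iff] at h; omega
  right_injective i j h := by simp [Fin.ext_iff] at h; omega
  left_ne_right i j h := by simp at h; omega
  apex_ne_left i h := by simp at h; omega
  apex_ne_right i h := by simp at h; omega

theorem two_pow_sq_le_of_solves (f : GraphProblem) (hf : f = xorConn ∨ f = xorBip) {n m : ℕ}
    (h : 2 * m < n) (P : OMAProtocol (SimpleGraph (Fin n)) (SimpleGraph (Fin n)))
    (hP : P.Solves (f n)) (k : ℕ)
    (hk : ((m * 2 ^ m : ℕ) : ℝ) * (4 ^ P.hcost * (8 / 9) ^ k) ≤ 1 / 2) :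
    2 ^ (m * m) ≤ 2 * 4 ^ (P.vcost * (2 * k)) := by
  have hA : Fintype.card (Fin m → Fin m → Bool) = 2 ^ (m * m) := by
    simp [pow_mul]
  have hB : Fintype.card (Fin m × (Fin m → Bool)) = m * 2 ^ m := by simp
  rw [← hA]
  rw [← hB] at hk
  let t := finTripod h
  rcases hf with rfl | rfl
  · refine P.card_le_of_separating hP t.aliceGraph t.connGraph (fun b b' hb => ?_) k hk
    funext i
    have := hb (i, b i)
    simp only [xorConn, decide_eq_decide, t.connected_iff] at this
    tauto
  · refine P.card_le_of_separating hP t.aliceGraph t.bipGraph (fun b b' hb => ?_) k hk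
    funext i
    have := hb (i, b i)
    simp only [xorBip, decide_eq_decide, t.isBipartite_iff] at this
    tauto

/-- The trade-off between help cost and verification cost. -/
theorem sq_le_hcost_add_mul_vcost (f : GraphProblem) (hf : f = xorConn ∨ f = xorBip) {n : ℕ}
    (hn : 8 ≤ n) (P : OMAProtocol (SimpleGraph (Fin n)) (SimpleGraph (Fin n)))
    (hP : P.Solves (f n)) :
    1 / 10000 * (n : ℝ) ^ 2 ≤ ((P.hcost : ℝ) + n) * (P.vcost : ℝ) := by
  obtain ⟨m, hm⟩ : ∃ m, m = (n - 1) / 2 := ⟨_, rfl⟩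
  have h2 : 2 * m < n := by omega
  have hm3 : 3 ≤ m := by omega
  have hmn : n ≤ 4 * m := by omega
  -- `2 ^ s` pays for the help strings, for `m * 2 ^ m ≤ 2 ^ (2 * m)` and for the final `1 / 2`;
  -- each factor 2 takes six steps of `k`, since `(8 / 9) ^ 6 ≤ 1 / 2`.
  obtain ⟨s, hs⟩ : ∃ s, s = 1 + 2 * P.hcost + 2 * m := ⟨_, rfl⟩
  have hk : ((m * 2 ^ m : ℕ) : ℝ) * (4 ^ P.hcost * (8 / 9) ^ (6 * s)) ≤ 1 / 2 := by
    have h1 : (m * 2 ^ m : ℕ) ≤ 2 ^ (2 * m) := by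
      rw [two_mul, pow_add]
      exact Nat.mul_le_mul_right _ Nat.lt_two_pow_self.le
    have h1' : ((m * 2 ^ m : ℕ) : ℝ) ≤ 2 ^ (2 * m) := by exact_mod_cast h1
    have h3 : ((8 : ℝ) / 9) ^ (6 * s) ≤ (1 / 2) ^ s := by
      rw [pow_mul]
      exact pow_le_pow_left₀ (by positivity) (by norm_num) _
    calc ((m * 2 ^ m : ℕ) : ℝ) * (4 ^ P.hcost * (8 / 9) ^ (6 * s))
        ≤ 2 ^ (2 * m) * (2 ^ (2 * P.hcost) * (1 / 2) ^ s) := by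
          rw [pow_mul 2 2 P.hcost]; norm_num only []; gcongr
      _ = 1 / 2 := by
          rw [hs, one_div, inv_pow, pow_add, pow_add]
          field_simp
  have hmain := two_pow_sq_le_of_solves f hf h2 P hP _ hk
  have hexp : m * m ≤ 1 + 2 * (P.vcost * (2 * (6 * s))) := by
    rw [show (4 : ℕ) = 2 ^ 2 from rfl, ← pow_mul, ← pow_succ'] at hmain
    have := (Nat.pow_le_pow_iff_right (by norm_num : 1 < 2)).mp hmain
    omega
  -- A positive `vcost` absorbs the additive 1 of `hexp` into the product.
  have hv : 1 ≤ P.vcost := by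
    by_contra hc
    have : P.vcost = 0 := by omega
    rw [this] at hexp
    nlinarith
  have h5 : s ≤ 2 * (P.hcost + n) := by omega
  have h6 : n * n ≤ 16 * (m * m) := by nlinarith
  have h7 : P.vcost * s ≤ P.vcost * (2 * (P.hcost + n)) := Nat.mul_le_mul_left _ h5
  have h8 : 1 ≤ P.vcost * (P.hcost + n) := Nat.mul_pos hv (by omega)
  have h9 : n * n ≤ 10000 * ((P.hcost + n) * P.vcost) := by nlinarith
  have h10 : (n : ℝ) * n ≤ 10000 * (((P.hcost : ℝ) + n) * P.vcost) := by exact_mod_cast h9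
  linarith [sq (n : ℝ)]

/-! ### Linear sketches that determine the connected components -/

section Sketch

variable {V : Type*}

/-- The edges of `H` that leave the vertex set `C`. -/
def edgeCut (H : SimpleGraph V) (C : Set V) : Set (Sym2 V) :=
  {e | e ∈ H.edgeSet ∧ ∃ u ∈ C, ∃ v, v ∉ C ∧ e = s(u, v)}

/-- The vertices that are reachable from `v`. -/
def reachSet (F : SimpleGraph V) (v : V) : Set V := {w | F.Reachable v w}

/-- The elements of `D` of maximal rank. -/
def maxRank {α : Type*} (r : α → ℕ) (D : Set α) : Set α := {e | e ∈ D ∧ ∀ e' ∈ D, r e' ≤ r e}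

/-- Borůvka's algorithm: in phase `i` all edges of maximal `ρ i`-rank that leave some component are
added. -/
def boruvka (H : SimpleGraph V) (ρ : ℕ → Sym2 V → ℕ) : ℕ → SimpleGraph V
  | 0 => ⊥
  | i + 1 => boruvka H ρ i ⊔ SimpleGraph.fromEdgeSet
      {e | ∃ v, e ∈ maxRank (ρ i) (edgeCut H (reachSet (boruvka H ρ i) v))}

theorem boruvka_le (H : SimpleGraph V) (ρ : ℕ → Sym2 V → ℕ) (i : ℕ) : boruvka H ρ i ≤ H := by
  induction i with
  | zero => exact bot_le
  | succ i ih =>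
    refine sup_le ih ?_
    rw [SimpleGraph.fromEdgeSet_le]
    rintro e ⟨⟨v, hv⟩, -⟩
    exact hv.1.1

/-- The cuts of phase `i` depend only on earlier ranks, so the ranks of phase `i` are fresh
randomness for them. -/
theorem boruvka_congr (H : SimpleGraph V) {ρ ρ' : ℕ → Sym2 V → ℕ} (i : ℕ)
    (h : ∀ k < i, ρ k = ρ' k) : boruvka H ρ i = boruvka H ρ' i := by
  induction i with
  | zero => rfl
  | succ i ih =>
    simp only [boruvka]
    rw [ih fun k hk => h k (by omega), h i (by omega)]

theorem maxRank_nonempty {α : Type*} [Finite α] (r : α → ℕ) {D : Set α} (h : D.Nonempty) :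
    (maxRank r D).Nonempty := by
  obtain ⟨e, he, hmax⟩ := Set.exists_max_image D r (Set.toFinite D) h
  exact ⟨e, he, hmax⟩

/-- After `i` phases every component has at least `2 ^ i` vertices or is a component of `H`. -/
theorem boruvka_growth [Finite V] (H : SimpleGraph V) (ρ : ℕ → Sym2 V → ℕ) (i : ℕ) (v : V) :
    2 ^ i ≤ (reachSet (boruvka H ρ i) v).ncard ∨
      edgeCut H (reachSet (boruvka H ρ i) v) = ∅ := by
  induction i generalizing v with
  | zero =>
    left
    rw [pow_zero, Nat.one_le_iff_ne_zero, ← Nat.pos_iff_ne_zero, Set.ncard_pos]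
    exact ⟨v, SimpleGraph.Reachable.refl _⟩
  | succ i ih =>
    have hmono : boruvka H ρ i ≤ boruvka H ρ (i + 1) := le_sup_left
    by_cases hC : edgeCut H (reachSet (boruvka H ρ i) v) = ∅
    · right
      have heq : reachSet (boruvka H ρ (i + 1)) v = reachSet (boruvka H ρ i) v := by
        ext w
        refine ⟨fun hw => ?_, fun hw => SimpleGraph.Reachable.mono hmono hw⟩
        obtain ⟨p⟩ := hw
        have hind : ∀ a c : V, (boruvka H ρ (i + 1)).Walk a c →
            a ∈ reachSet (boruvka H ρ i) v → c ∈ reachSet (boruvka H ρ i) v := by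
          intro a c p
          induction p with
          | nil => exact id
          | @cons a b c hab _ ih' =>
            intro ha
            apply ih'
            by_contra hb
            have : s(a, b) ∈ edgeCut H (reachSet (boruvka H ρ i) v) :=
              ⟨boruvka_le H ρ (i + 1) hab, a, ha, b, hb, rfl⟩
            rw [hC] at this
            exact this
        exact hind v w p (SimpleGraph.Reachable.refl _)
      rw [heq]
      exact hC
    · left
      obtain ⟨e, he⟩ := maxRank_nonempty (ρ i) (Set.nonempty_iff_ne_empty.mpr hC)
      obtain ⟨heH, a, ha, b, hb, rfl⟩ := he.1
      have hab : (boruvka H ρ (i + 1)).Adj a b := by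
        right
        rw [SimpleGraph.fromEdgeSet_adj]
        exact ⟨⟨v, he⟩, SimpleGraph.Adj.ne heH⟩
      -- The same edge leaves the component of `b`, so by induction that one is large too, and the
      -- merged component doubles.
      have hbcut : s(b, a) ∈ edgeCut H (reachSet (boruvka H ρ i) b) := by
        refine ⟨by rw [Sym2.eq_swap]; exact heH, b, SimpleGraph.Reachable.refl _, a, ?_, rfl⟩
        intro hba
        exact hb (SimpleGraph.Reachable.trans ha hba.symm)
      have h1 := (ih v).resolve_right hC
      have h2 := (ih b).resolve_right (Set.nonempty_iff_ne_empty.mp ⟨_, hbcut⟩)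
      have hdisj : Disjoint (reachSet (boruvka H ρ i) v) (reachSet (boruvka H ρ i) b) := by
        rw [Set.disjoint_left]
        intro w hw hw'
        exact hb (SimpleGraph.Reachable.trans hw (SimpleGraph.Reachable.symm hw'))
      have hsub : reachSet (boruvka H ρ i) v ∪ reachSet (boruvka H ρ i) b ⊆
          reachSet (boruvka H ρ (i + 1)) v := by
        have hvb : (boruvka H ρ (i + 1)).Reachable v b :=
          (SimpleGraph.Reachable.mono hmono ha).trans hab.reachable
        rintro w (hw | hw)
        · exact SimpleGraph.Reachable.mono hmono hw
        · exact hvb.trans (SimpleGraph.Reachable.mono hmono hw)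
      have h3 := Set.ncard_le_ncard hsub (Set.toFinite _)
      rw [Set.ncard_union_eq hdisj (Set.toFinite _) (Set.toFinite _)] at h3
      rw [pow_succ]
      omega

theorem reachable_boruvka_iff [Finite V] (H : SimpleGraph V) (ρ : ℕ → Sym2 V → ℕ) {T : ℕ}
    (hT : Nat.card V < 2 ^ T) (v w : V) : (boruvka H ρ T).Reachable v w ↔ H.Reachable v w := by
  refine ⟨SimpleGraph.Reachable.mono (boruvka_le H ρ T), ?_⟩
  have hC : edgeCut H (reachSet (boruvka H ρ T) v) = ∅ := by
    refine (boruvka_growth H ρ T v).resolve_left fun h => ?_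
    have := Set.ncard_le_card (reachSet (boruvka H ρ T) v)
    omega
  rintro ⟨p⟩
  have hind : ∀ a c : V, H.Walk a c →
      a ∈ reachSet (boruvka H ρ T) v → c ∈ reachSet (boruvka H ρ T) v := by
    intro a c p
    induction p with
    | nil => exact id
    | @cons a b c hab _ ih' =>
      intro ha
      apply ih'
      by_contra hb
      have : s(a, b) ∈ edgeCut H (reachSet (boruvka H ρ T) v) := ⟨hab, a, ha, b, hb, rfl⟩
      rw [hC] at this
      exact this
  exact hind v w p (SimpleGraph.Reachable.refl _)

/-! ### Sparse-injective maps and recovery of top-rank edges -/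

open Classical in
/-- `φ` is injective on sums of at most `t` distinct terms. -/
def IsSparseInjective {α W : Type*} [Fintype α] [AddCommGroup W] (φ : α → W) (t : ℕ) : Prop :=
  ∀ S S' : Set α, S.ncard ≤ t → S'.ncard ≤ t →
    ∑ e, (if e ∈ S then φ e else 0) = ∑ e, (if e ∈ S' then φ e else 0) → S = S'

open Classical in
/-- The sum of `φ` over the elements of `D` of rank `j`. -/
noncomputable def rankSum {α W : Type*} [Fintype α] [AddCommGroup W] (φ : α → W) (r : α → ℕ)
    (D : Set α) (j : ℕ) : W :=
  ∑ e, if e ∈ D ∧ r e = j then φ e else 0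

section MaxRank

variable {α W : Type*} [Fintype α] [AddCommGroup W] {φ : α → W} {t J : ℕ} {r : α → ℕ}

/-- Otherwise `D` contributes 0 at rank `r e₀`, whereas `D'` contributes the sparse sum over its
nonempty top-rank set, which sparse injectivity separates from 0. -/
theorem exists_rank_ge (hφ : IsSparseInjective φ t) {D D' : Set α}
    (hJ' : ∀ e ∈ D', r e < J) (ht' : (maxRank r D').ncard ≤ t)
    (h : ∀ j < J, rankSum φ r D j = rankSum φ r D' j) {e₀ : α} (he₀ : e₀ ∈ maxRank r D') :
    ∃ e ∈ D, r e₀ ≤ r e := by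
  classical
  by_contra! hc
  have h1 := h (r e₀) (hJ' _ he₀.1)
  have h2 : maxRank r D' = ∅ := by
    refine hφ _ _ ht' (by simp) ?_
    rw [rankSum, rankSum] at h1
    have h3 : ∀ e, ¬ (e ∈ D ∧ r e = r e₀) := fun e he => (hc e he.1).ne he.2
    simp only [h3, if_false, Finset.sum_const_zero] at h1
    simp only [Set.mem_empty_iff_false, if_false, Finset.sum_const_zero]
    refine Eq.trans (Finset.sum_congr rfl fun e _ => ?_) h1.symm
    congr 1
    refine propext ⟨fun he => ⟨he.1, le_antisymm (he₀.2 e he.1) (he.2 e₀ he₀.1)⟩, fun he => ?_⟩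
    exact ⟨he.1, fun e' he' => he.2 ▸ he₀.2 e' he'⟩
  rw [h2] at he₀
  exact he₀

/-- Comparing both ways shows that the top ranks agree; at that rank the two sums run exactly over
the top-rank sets, which are sparse. -/
theorem maxRank_eq_of_rankSum_eq (hφ : IsSparseInjective φ t) {D D' : Set α}
    (hJ : ∀ e ∈ D, r e < J) (hJ' : ∀ e ∈ D', r e < J)
    (ht : (maxRank r D).ncard ≤ t) (ht' : (maxRank r D').ncard ≤ t)
    (h : ∀ j < J, rankSum φ r D j = rankSum φ r D' j) : maxRank r D = maxRank r D' := by
  classical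
  rcases D.eq_empty_or_nonempty with hD | hD
  · rcases D'.eq_empty_or_nonempty with hD' | hD'
    · rw [hD, hD']
    · obtain ⟨e₀, he₀⟩ := maxRank_nonempty r hD'
      obtain ⟨e, he, -⟩ := exists_rank_ge hφ hJ' ht' h he₀
      rw [hD] at he
      exact absurd he (Set.notMem_empty e)
  · obtain ⟨e₁, he₁⟩ := maxRank_nonempty r hD
    obtain ⟨e', he', hle'⟩ := exists_rank_ge hφ hJ ht (fun j hj => (h j hj).symm) he₁
    obtain ⟨e₀, he₀⟩ := maxRank_nonempty r ⟨e', he'⟩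
    obtain ⟨e, he, hle⟩ := exists_rank_ge hφ hJ' ht' h he₀
    have hr : r e₀ = r e₁ := le_antisymm (hle.trans (he₁.2 e he)) (hle'.trans (he₀.2 e' he'))
    refine hφ _ _ ht ht' ?_
    have h1 := h (r e₁) (hJ _ he₁.1)
    have hmem : ∀ {D : Set α} {e₀ : α}, e₀ ∈ maxRank r D → ∀ e,
        (e ∈ maxRank r D) = (e ∈ D ∧ r e = r e₀) := by
      intro D e₀ he₀ e
      refine propext ⟨fun he => ⟨he.1, le_antisymm (he₀.2 e he.1) (he.2 e₀ he₀.1)⟩, fun he => ?_⟩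
      exact ⟨he.1, fun e' he' => he.2 ▸ he₀.2 e' he'⟩
    simp only [hmem he₁, hmem he₀, hr]
    exact h1

end MaxRank

variable [Fintype V] {W : Type*} [AddCommGroup W]

/-- The linear sketch of the edges of rank `j` at the vertex `v`. -/
noncomputable def vertexSketch [DecidableEq V] (φ : Sym2 V → W) (r : Sym2 V → ℕ)
    (H : SimpleGraph V) (j : ℕ) (v : V) : W :=
  rankSum φ r {e | e ∈ H.edgeSet ∧ v ∈ e} j

theorem vertexSketch_symmDiff [DecidableEq V] (hW : ∀ w : W, w + w = 0) (φ : Sym2 V → W)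
    (r : Sym2 V → ℕ) (A B : SimpleGraph V) (j : ℕ) (v : V) :
    vertexSketch φ r (A ∆ B) j v = vertexSketch φ r A j v + vertexSketch φ r B j v := by
  classical
  unfold vertexSketch rankSum
  rw [← Finset.sum_add_distrib]
  refine Finset.sum_congr rfl fun e _ => ?_
  have he : e ∈ (A ∆ B).edgeSet ↔ ¬ (e ∈ A.edgeSet ↔ e ∈ B.edgeSet) := by
    induction e with
    | _ a b => exact SimpleGraph.symmDiff_adj_iff A B a b
  simp only [Set.mem_ofPred_eq, he]
  by_cases h1 : e ∈ A.edgeSet <;> by_cases h2 : e ∈ B.edgeSet <;>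
    by_cases h3 : v ∈ e ∧ r e = j <;> simp_all

-- An edge inside `C` is counted at both ends and cancels in characteristic 2; an edge of the cut is
-- counted once.
open Classical in
theorem sum_vertexSketch (hW : ∀ w : W, w + w = 0) (φ : Sym2 V → W)
    (r : Sym2 V → ℕ) (H : SimpleGraph V) (j : ℕ) (C : Set V) :
    ∑ v, (if v ∈ C then vertexSketch φ r H j v else 0) = rankSum φ r (edgeCut H C) j := by
  have h1 : ∀ v, (if v ∈ C then vertexSketch φ r H j v else 0) =
      ∑ e, if v ∈ C ∧ (e ∈ H.edgeSet ∧ v ∈ e) ∧ r e = j then φ e else 0 := by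
    intro v
    by_cases hv : v ∈ C
    · simp only [hv, vertexSketch, rankSum, if_true, Set.mem_ofPred_eq, true_and]
      exact Finset.sum_congr rfl fun e _ => by congr
    · simp [hv]
  simp only [h1]
  rw [Finset.sum_comm, rankSum]
  refine Finset.sum_congr rfl fun e _ => ?_
  by_cases he : e ∈ H.edgeSet ∧ r e = j
  · obtain ⟨he, hr⟩ := he
    induction e with
    | _ a b =>
      have hne : a ≠ b := SimpleGraph.Adj.ne he
      have h2 : ∀ v, (if v ∈ C ∧ (s(a, b) ∈ H.edgeSet ∧ v ∈ s(a, b)) ∧ r s(a, b) = j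
          then φ s(a, b) else 0) = (if v = a then (if a ∈ C then φ s(a, b) else 0) else 0) +
            (if v = b then (if b ∈ C then φ s(a, b) else 0) else 0) := by
        intro v
        by_cases hva : v = a
        · subst hva
          simp [hne, he, hr]
        · by_cases hvb : v = b
          · subst hvb
            simp [hva, he, hr]
          · simp [hva, hvb]
      simp only [h2, Finset.sum_add_distrib, Finset.sum_ite_eq', Finset.mem_univ, if_true]
      have h3 : (s(a, b) ∈ edgeCut H C) ↔ ¬ (a ∈ C ↔ b ∈ C) := by
        constructor
        · rintro ⟨-, u, hu, v, hv, huv⟩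
          rcases Sym2.eq_iff.mp huv with ⟨rfl, rfl⟩ | ⟨rfl, rfl⟩ <;> tauto
        · intro h
          by_cases ha : a ∈ C
          · exact ⟨he, a, ha, b, by tauto, rfl⟩
          · exact ⟨he, b, by tauto, a, ha, Sym2.eq_swap⟩
      simp only [h3, hr, and_true]
      by_cases ha : a ∈ C <;> by_cases hb : b ∈ C <;> simp [ha, hb, hW]
  · rw [if_neg fun h => he ⟨h.1.1, h.2⟩]
    refine Finset.sum_eq_zero fun v _ => if_neg fun h => he ⟨h.2.1.1, h.2.2⟩

/-- The ranks `ρ` are good for `H`: in each of the first `T` phases, every component leaves by at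
most `t` edges of maximal rank, and only by edges of rank less than `J`. -/
def GoodRanks (T J t : ℕ) (ρ : ℕ → Sym2 V → ℕ) (H : SimpleGraph V) : Prop :=
  ∀ i < T, ∀ v, (∀ e ∈ edgeCut H (reachSet (boruvka H ρ i) v), ρ i e < J) ∧
    (maxRank (ρ i) (edgeCut H (reachSet (boruvka H ρ i) v))).ncard ≤ t

/-- If the two runs agree so far, they have the same components, hence equal cut sketches, hence the
same top-rank edges to add. -/
theorem boruvka_eq_of_vertexSketch_eq [DecidableEq V] (hW : ∀ w : W, w + w = 0) {φ : Sym2 V → W}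
    {T J t : ℕ} (hφ : IsSparseInjective φ t) {ρ : ℕ → Sym2 V → ℕ} {H H' : SimpleGraph V}
    (hH : GoodRanks T J t ρ H) (hH' : GoodRanks T J t ρ H')
    (h : ∀ i < T, ∀ j < J, ∀ v, vertexSketch φ (ρ i) H j v = vertexSketch φ (ρ i) H' j v)
    (i : ℕ) (hi : i ≤ T) : boruvka H ρ i = boruvka H' ρ i := by
  classical
  induction i with
  | zero => rfl
  | succ i ih =>
    have ih := ih (by omega)
    simp only [boruvka]
    rw [← ih]
    congr 2
    ext e
    refine exists_congr fun v => ?_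
    obtain ⟨h1, h2⟩ := hH i (by omega) v
    obtain ⟨h3, h4⟩ := hH' i (by omega) v
    rw [← ih] at h3 h4
    rw [maxRank_eq_of_rankSum_eq hφ h1 h3 h2 h4]
    intro j hj
    rw [← sum_vertexSketch hW, ← sum_vertexSketch hW]
    refine Finset.sum_congr rfl fun u _ => ?_
    have := h i (by omega) j hj u
    congr 1

/-- Two graphs with the same sketches, for which the ranks are good, have the same components. -/
theorem reachable_iff_of_vertexSketch_eq [DecidableEq V] (hW : ∀ w : W, w + w = 0)
    {φ : Sym2 V → W} {T J t : ℕ} (hT : Fintype.card V < 2 ^ T) (hφ : IsSparseInjective φ t)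
    {ρ : ℕ → Sym2 V → ℕ} {H H' : SimpleGraph V}
    (hH : GoodRanks T J t ρ H) (hH' : GoodRanks T J t ρ H')
    (h : ∀ i < T, ∀ j < J, ∀ v, vertexSketch φ (ρ i) H j v = vertexSketch φ (ρ i) H' j v)
    (v w : V) : H.Reachable v w ↔ H'.Reachable v w := by
  rw [← Nat.card_eq_fintype_card] at hT
  rw [← reachable_boruvka_iff H ρ hT, ← reachable_boruvka_iff H' ρ hT,
    boruvka_eq_of_vertexSketch_eq hW hφ hH hH' h T le_rfl]

end Sketch

/-- Points on the moment curve give a sparse-injective map. -/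
theorem isSparseInjective_momentCurve {α K : Type*} [Fintype α] [Field K] {g : α → K}
    (hg : Function.Injective g) (t : ℕ) :
    IsSparseInjective (fun e => fun i : Fin (2 * t) => g e ^ (i : ℕ)) t := by
  classical
  intro S S' hS hS' h
  -- The difference of the indicators has at most `2 * t` support points and annihilates all
  -- polynomials of degree below `2 * t`. Testing it on the polynomial vanishing at all support
  -- points but one isolates that coefficient.
  let c : α → K := fun e => (if e ∈ S then 1 else 0) - (if e ∈ S' then 1 else 0)
  have hc : ∀ p : Polynomial K, p.natDegree < 2 * t → ∑ e, c e * p.eval (g e) = 0 := by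
    intro p hp
    have h1 : ∀ i < 2 * t, ∑ e, c e * g e ^ i = 0 := by
      intro i hi
      have := congrFun h ⟨i, hi⟩
      simp only [Finset.sum_apply, ite_apply, Pi.zero_apply] at this
      simp only [c, sub_mul, Finset.sum_sub_distrib, ite_mul, one_mul, zero_mul]
      exact sub_eq_zero.mpr this
    simp only [Polynomial.eval_eq_sum_range' hp, Finset.mul_sum]
    rw [Finset.sum_comm]
    refine Finset.sum_eq_zero fun i hi => ?_
    have h2 := h1 i (Finset.mem_range.mp hi)
    calc ∑ e, c e * (p.coeff i * g e ^ i) = p.coeff i * ∑ e, c e * g e ^ i := by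
          rw [Finset.mul_sum]; exact Finset.sum_congr rfl fun e _ => by ring
      _ = 0 := by rw [h2, mul_zero]
  let U : Finset α := S.toFinset ∪ S'.toFinset
  have hU : U.card ≤ 2 * t := by
    refine (Finset.card_union_le _ _).trans ?_
    rw [← Set.ncard_eq_toFinset_card', ← Set.ncard_eq_toFinset_card']
    omega
  have hzero : ∀ e₀, c e₀ = 0 := by
    intro e₀
    by_cases he₀ : e₀ ∈ U
    · let p : Polynomial K := ∏ e ∈ U.erase e₀, (Polynomial.X - Polynomial.C (g e))
      have hp : p.natDegree < 2 * t := by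
        rw [Polynomial.natDegree_prod_of_monic _ _ fun e _ => Polynomial.monic_X_sub_C _]
        simp only [Polynomial.natDegree_X_sub_C, Finset.sum_const, smul_eq_mul, mul_one]
        have := Finset.card_erase_lt_of_mem he₀
        omega
      have h1 := hc p hp
      rw [Finset.sum_eq_single e₀] at h1
      · refine (mul_eq_zero.mp h1).resolve_right ?_
        rw [Polynomial.eval_prod]
        refine Finset.prod_ne_zero_iff.mpr fun e he => ?_
        simp only [Polynomial.eval_sub, Polynomial.eval_X, Polynomial.eval_C]
        exact sub_ne_zero.mpr fun h' => (Finset.ne_of_mem_erase he) (hg h').symm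
      · intro e _ hne
        by_cases he : e ∈ U
        · have : p.eval (g e) = 0 := by
            rw [Polynomial.eval_prod]
            exact Finset.prod_eq_zero (Finset.mem_erase.mpr ⟨hne, he⟩) (by simp)
          rw [this, mul_zero]
        · have h2 : e ∉ S ∧ e ∉ S' := by simpa [U] using he
          simp [c, h2]
      · simp
    · have h2 : e₀ ∉ S ∧ e₀ ∉ S' := by simpa [U] using he₀
      simp [c, h2]
  ext e
  have := hzero e
  by_cases h1 : e ∈ S <;> by_cases h2 : e ∈ S' <;> simp [c, h1, h2] at this ⊢

/-! ### Random ranks are good -/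

section RandomRanks

/-- The number of leading successes of `e` in the coin tosses `b`: a geometric random variable,
truncated at `J`. -/
noncomputable def bitRank {κ : Type*} {J : ℕ} (b : Fin J → κ → Bool) (e : κ) : ℕ := by
  classical exact Nat.findGreatest (fun j => ∀ i : Fin J, (i : ℕ) < j → b i e = true) J

theorem le_bitRank_iff {κ : Type*} {J : ℕ} (b : Fin J → κ → Bool) (e : κ) {j : ℕ} (hj : j ≤ J) :
    j ≤ bitRank b e ↔ ∀ i : Fin J, (i : ℕ) < j → b i e = true := by
  classical
  unfold bitRank
  constructor
  · intro h i hi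
    exact Nat.findGreatest_spec (P := fun j => ∀ i : Fin J, (i : ℕ) < j → b i e = true)
      (Nat.zero_le J) (fun i hi => absurd hi (Nat.not_lt_zero _)) i (by omega)
  · intro h
    exact Nat.le_findGreatest hj h

/-- The first term bounds the chance of an element succeeding in all `J` rounds. Otherwise, if the
top rank is `j`, the top-rank set consists of the survivors of the first `j` rounds, all of which
fail in the next one; for more than `t` survivors this has probability at most `(1 / 2) ^ (t + 1)`.
-/
theorem unifProb_bitRank_bad_le {κ : Type*} [Fintype κ] [DecidableEq κ] (J t : ℕ) (D : Set κ) :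
    unifProb (fun b : Fin J → κ → Bool => ¬ ((∀ e ∈ D, bitRank b e < J) ∧
      (maxRank (bitRank b) D).ncard ≤ t)) ≤
      Fintype.card κ * (1 / 2) ^ J + J * (1 / 2) ^ (t + 1) := by
  classical
  have h1 : ∀ e : κ, unifProb (fun b : Fin J → κ → Bool => ∀ i, b i e = true) ≤
      (1 / 2) ^ J := by
    intro e
    refine (unifProb_forall_le (fun c : κ → Bool => c e = true)).trans ?_
    rw [Fintype.card_fin]
    refine pow_le_pow_left₀ (unifProb_nonneg _) ?_ _
    simpa using unifProb_forall_mem_eq_le {e} true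
  have h2 : ∀ j : Fin J, unifProb (fun b : Fin J → κ → Bool =>
      t < {e | e ∈ D ∧ ∀ i : Fin J, i < j → b i e = true}.ncard ∧
      ∀ e ∈ D, (∀ i : Fin J, i < j → b i e = true) → b j e = false) ≤ (1 / 2) ^ (t + 1) := by
    intro j
    refine unifProb_le_of_update _ j fun b => ?_
    have hupd : ∀ (c : κ → Bool) (e : κ), (∀ i : Fin J, i < j →
        Function.update b j c i e = true) ↔ ∀ i : Fin J, i < j → b i e = true := by
      intro c e
      refine forall_congr' fun i => forall_congr' fun hi => ?_
      rw [Function.update_of_ne hi.ne]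
    simp only [hupd, Function.update_self]
    by_cases ht : t < {e | e ∈ D ∧ ∀ i : Fin J, i < j → b i e = true}.ncard
    · have h3 := unifProb_forall_mem_eq_le
        {e | e ∈ D ∧ ∀ i : Fin J, i < j → b i e = true}.toFinset false
      rw [← Set.ncard_eq_toFinset_card'] at h3
      refine (unifProb_mono ?_).trans (h3.trans
        (pow_le_pow_of_le_one (by norm_num) (by norm_num) ht))
      rintro c ⟨-, hc⟩ e he
      have he : e ∈ D ∧ ∀ i : Fin J, i < j → b i e = true := by simpa using he
      exact hc e he.1 he.2
    · rw [unifProb_eq_zero fun c hc => ht hc.1]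
      positivity
  have h3 := unifProb_exists_le_card_mul _ h1
  have h4 := unifProb_exists_le_card_mul _ h2
  rw [Fintype.card_fin] at h4
  refine (unifProb_mono ?_).trans ((unifProb_or_le _ _).trans (add_le_add h3 h4))
  intro b hb
  by_cases hlt : ∀ e ∈ D, bitRank b e < J
  · right
    have hcard : t < (maxRank (bitRank b) D).ncard := by
      by_contra hc
      exact hb ⟨hlt, by omega⟩
    obtain ⟨e₀, he₀⟩ := Set.nonempty_of_ncard_ne_zero (s := maxRank (bitRank b) D) (by omega)
    refine ⟨⟨bitRank b e₀, hlt e₀ he₀.1⟩, ?_, ?_⟩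
    · refine hcard.trans_le (Set.ncard_le_ncard ?_ (Set.toFinite _))
      intro e he
      refine ⟨he.1, fun i hi => ?_⟩
      exact (le_bitRank_iff b e (hlt e₀ he₀.1).le).mp (he.2 e₀ he₀.1) i hi
    · intro e he hbits
      by_contra hne
      have hsucc : bitRank b e₀ + 1 ≤ bitRank b e := by
        rw [le_bitRank_iff b e (hlt e₀ he₀.1)]
        intro i hi
        rcases Nat.lt_succ_iff_lt_or_eq.mp hi with h | h
        · exact hbits i h
        · rw [show i = ⟨bitRank b e₀, hlt e₀ he₀.1⟩ from Fin.ext h]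
          simpa using hne
      have := he₀.2 e he
      omega
  · left
    push Not at hlt
    obtain ⟨e, -, he⟩ := hlt
    exact ⟨e, fun i => (le_bitRank_iff b e le_rfl).mp he i i.2⟩

variable {V : Type*} [Fintype V] [DecidableEq V]

/-- The ranks in the first `T` phases, from independent coin tosses. -/
noncomputable def phaseRanks {T J : ℕ} (ω : Fin T → Fin J → Sym2 V → Bool) : ℕ → Sym2 V → ℕ :=
  fun i => if h : i < T then bitRank (ω ⟨i, h⟩) else 0

/-- Resampling the coins of phase `i` alone leaves its cuts fixed, so the bound for a fixed set
applies; the rest is a union bound over phases and vertices. -/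
theorem unifProb_not_goodRanks_le (T J t : ℕ) (H : SimpleGraph V) :
    unifProb (fun ω : Fin T → Fin J → Sym2 V → Bool => ¬ GoodRanks T J t (phaseRanks ω) H) ≤
      T * (Fintype.card V *
        (Fintype.card (Sym2 V) * (1 / 2) ^ J + J * (1 / 2) ^ (t + 1))) := by
  have h1 : ∀ (i : Fin T) (v : V), unifProb (fun ω : Fin T → Fin J → Sym2 V → Bool =>
      ¬ ((∀ e ∈ edgeCut H (reachSet (boruvka H (phaseRanks ω) i) v), phaseRanks ω i e < J) ∧
        (maxRank (phaseRanks ω i)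
          (edgeCut H (reachSet (boruvka H (phaseRanks ω) i) v))).ncard ≤ t)) ≤
      Fintype.card (Sym2 V) * (1 / 2) ^ J + J * (1 / 2) ^ (t + 1) := by
    intro i v
    refine unifProb_le_of_update _ i fun ω => ?_
    have h2 : ∀ b, boruvka H (phaseRanks (Function.update ω i b)) i =
        boruvka H (phaseRanks ω) i := by
      intro b
      refine boruvka_congr H i fun k hk => ?_
      have hkT : k < T := hk.trans i.2
      simp only [phaseRanks, hkT, dif_pos]
      rw [Function.update_of_ne (by rw [Ne, Fin.ext_iff]; exact hk.ne)]
    have h3 : ∀ b, phaseRanks (Function.update ω i b) i = bitRank b := by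
      intro b
      simp [phaseRanks]
    simp only [h2, h3]
    exact unifProb_bitRank_bad_le J t _
  have h2 := unifProb_exists_le_card_mul _ fun i => unifProb_exists_le_card_mul _ (h1 i)
  rw [Fintype.card_fin] at h2
  refine (unifProb_mono ?_).trans h2
  intro ω hω
  simp only [GoodRanks, not_forall] at hω
  obtain ⟨i, hi, v, h⟩ := hω
  exact ⟨⟨i, hi⟩, v, h⟩

/-- With the parameters below, random ranks are good with high probability. -/
theorem unifProb_not_goodRanks_le_of_card_le {l : ℕ} (hV : Fintype.card V ≤ 2 ^ l)
    (H : SimpleGraph V) :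
    unifProb (fun ω : Fin (l + 1) → Fin (5 * l + 10) → Sym2 V → Bool =>
      ¬ GoodRanks (l + 1) (5 * l + 10) (5 * l + 10) (phaseRanks ω) H) ≤ 1 / 16 := by
  refine (unifProb_not_goodRanks_le _ _ _ H).trans ?_
  have hl : l + 1 ≤ 2 ^ l := Nat.lt_two_pow_self
  have hl' : ((l + 1 : ℕ) : ℝ) ≤ 2 ^ l := by exact_mod_cast hl
  have hJ' : ((5 * l + 10 : ℕ) : ℝ) ≤ 2 ^ l * 16 := by
    have : 5 * l + 10 ≤ 2 ^ l * 16 := by omega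
    exact_mod_cast this
  have hV' : (Fintype.card V : ℝ) ≤ 2 ^ l := by exact_mod_cast hV
  have hE : (Fintype.card (Sym2 V) : ℝ) ≤ 2 ^ (2 * l) := by
    have h1 : Fintype.card (Sym2 V) ≤ Fintype.card (V × V) :=
      Fintype.card_le_of_surjective (fun p : V × V => s(p.1, p.2))
        fun e => by induction e with | _ a b => exact ⟨(a, b), rfl⟩
    rw [Fintype.card_prod] at h1
    have h2 : Fintype.card (Sym2 V) ≤ 2 ^ (2 * l) := by
      rw [two_mul, pow_add]
      exact h1.trans (Nat.mul_le_mul hV hV)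
    exact_mod_cast h2
  have hx : (1 : ℝ) ≤ 2 ^ l := one_le_pow₀ (by norm_num)
  -- Five powers of `2 ^ l` beat the at most four coming from phases, vertices and edges.
  have hpow : ((1 : ℝ) / 2) ^ (5 * l + 10) = 1 / 1024 / (2 ^ l) ^ 5 := by
    rw [one_div, inv_pow, pow_add, mul_comm 5 l, pow_mul]
    norm_num
    ring
  calc ((l + 1 : ℕ) : ℝ) * (Fintype.card V * (Fintype.card (Sym2 V) * (1 / 2) ^ (5 * l + 10) +
        ((5 * l + 10 : ℕ) : ℝ) * (1 / 2) ^ (5 * l + 10 + 1)))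
      ≤ 2 ^ l * (2 ^ l * (2 ^ (2 * l) * (1 / 2) ^ (5 * l + 10) +
        (2 ^ l * 16) * (1 / 2) ^ (5 * l + 10 + 1))) := by gcongr
    _ ≤ 1 / 16 := by
        rw [pow_succ (1 / 2 : ℝ) (5 * l + 10), hpow, mul_comm 2 l, pow_mul]
        generalize (2 : ℝ) ^ l = x at hx
        have hx0 : 0 < x := by linarith
        have h1 : x * (x * (x ^ 2 * (1 / 1024 / x ^ 5) + x * 16 * (1 / 1024 / x ^ 5 * (1 / 2)))) =
            1 / 1024 / x + 1 / 128 / x ^ 2 := by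
          field_simp
          ring
        rw [h1]
        have h2 : 1 / 1024 / x ≤ 1 / 1024 := div_le_self (by norm_num) hx
        have h3 : 1 / 128 / x ^ 2 ≤ 1 / 128 := div_le_self (by norm_num) (one_le_pow₀ hx)
        linarith

end RandomRanks

/-- Newman's argument: for finitely many rare events, few seeds suffice. -/
theorem exists_seeds {Ω 𝓗 : Type*} [Fintype Ω] [Nonempty Ω] [Fintype 𝓗] (Bad : 𝓗 → Ω → Prop)
    (h : ∀ H, unifProb (Bad H) ≤ 1 / 16) {s : ℕ} (hs : Fintype.card 𝓗 < 2 ^ 2 ^ s) :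
    ∃ g : (Fin (s + 3) → Bool) → Ω, ∀ H, coinProb (fun r => Bad H (g r)) ≤ 1 / 3 := by
  classical
  have h1 : ∀ H, unifProb (fun g : (Fin (s + 3) → Bool) → Ω =>
      2 * 2 ^ s ≤ (Finset.univ.filter fun r => Bad H (g r)).card) ≤ (1 / 2) ^ 2 ^ s := by
    intro H
    refine (unifProb_card_ge_le (Bad H) (2 * 2 ^ s) (h H)).trans ?_
    have hcard : Fintype.card (Fin (s + 3) → Bool) = 8 * 2 ^ s := by
      simp [pow_add, mul_comm]
    rw [hcard, pow_mul, pow_mul, ← div_pow]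
    -- The base is `(17 / 16) ^ 8 / 4`, which is below `1 / 2`.
    exact pow_le_pow_left₀ (by norm_num) (by norm_num) _
  have h2 := unifProb_exists_le_card_mul _ h1
  obtain ⟨g, hg⟩ := exists_not_of_unifProb_lt_one (lt_of_le_of_lt h2 (by
    have : (Fintype.card 𝓗 : ℝ) < 2 ^ 2 ^ s := by exact_mod_cast hs
    rw [one_div, inv_pow]
    rw [mul_inv_lt_iff₀ (by positivity), one_mul]
    exact this))
  refine ⟨g, fun H => ?_⟩
  have h3 : (Finset.univ.filter fun r => Bad H (g r)).card < 2 * 2 ^ s := by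
    by_contra hc
    exact hg ⟨H, by omega⟩
  rw [coinProb_eq_unifProb, unifProb_eq, div_le_iff₀ (by exact_mod_cast Fintype.card_pos)]
  have hcard : Fintype.card (Fin (s + 3) → Bool) = 8 * 2 ^ s := by
    simp [pow_add, mul_comm]
  rw [hcard]
  have h4 : ((Finset.univ.filter fun r => Bad H (g r)).card : ℝ) < 2 * 2 ^ s := by
    exact_mod_cast h3
  push_cast
  have : (0 : ℝ) < 2 ^ s := by positivity
  linarith

/-! ### One-way protocols from sketches -/

theorem exists_encoding {M : Type*} [Fintype M] {b : ℕ} (h : Fintype.card M ≤ 2 ^ b) :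
    ∃ enc : M → List Bool, Function.Injective enc ∧ ∀ m, (enc m).length = b := by
  have : Nonempty (M ↪ (Fin b → Bool)) := by
    apply Function.Embedding.nonempty_of_card_le
    simpa using h
  obtain ⟨g⟩ := this
  exact ⟨fun m => List.ofFn (g m), fun m m' h => g.injective (List.ofFn_injective h),
    fun m => by simp⟩

theorem card_simpleGraph_fin_le (n : ℕ) : Fintype.card (SimpleGraph (Fin n)) ≤ 2 ^ (n * n) := by
  classical
  have : Function.Injective fun (G : SimpleGraph (Fin n)) (u v : Fin n) => decide (G.Adj u v) := by
    intro G G' h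
    ext u v
    simpa using congrFun (congrFun h u) v
  have h := Fintype.card_le_of_injective _ this
  simpa [pow_mul] using h

/-- A bound on the length of the sketch of a graph with `N ≤ 2 ^ l` vertices. -/
def sketchLength (N l : ℕ) : ℕ :=
  (2 * l + 4) + (2 * l + 1) * (2 * (5 * l + 10)) * N * (5 * l + 10) * (l + 1)

/-- A predicate of `A ∆ B` that depends only on the components of a graph depending linearly on
`A ∆ B` has a short one-way protocol. -/
theorem exists_oneWayProtocol {n l : ℕ} {V : Type} [Fintype V] [DecidableEq V]
    (hV : Fintype.card V ≤ 2 ^ l) (hn : n ≤ 2 ^ l)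
    (F : SimpleGraph (Fin n) → Bool) (Φ : SimpleGraph (Fin n) → SimpleGraph V)
    (hΦ : ∀ A B, Φ (A ∆ B) = Φ A ∆ Φ B)
    (hF : ∀ G G', (∀ u v, (Φ G).Reachable u v ↔ (Φ G').Reachable u v) → F G = F G') :
    ∃ P : OneWayProtocol (SimpleGraph (Fin n)) (SimpleGraph (Fin n)),
      P.Solves (fun A B => F (A ∆ B)) ∧ P.cost ≤ sketchLength (Fintype.card V) l := by
  classical
  let t := 5 * l + 10
  -- Large enough to give each pair of vertices its own element; the exponent is nonzero even for `l
  -- = 0`.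
  let K := GaloisField 2 (2 * l + 1)
  have : Fintype K := Fintype.ofFinite K
  have hK : Fintype.card K = 2 ^ (2 * l + 1) := by
    rw [← Nat.card_eq_fintype_card]
    exact GaloisField.card 2 _ (by omega)
  have hE : Fintype.card (Sym2 V) ≤ Fintype.card K := by
    have h1 : Fintype.card (Sym2 V) ≤ Fintype.card (V × V) :=
      Fintype.card_le_of_surjective (fun p : V × V => s(p.1, p.2))
        fun e => by induction e with | _ a b => exact ⟨(a, b), rfl⟩
    rw [Fintype.card_prod] at h1
    rw [hK, pow_succ, two_mul, pow_add]
    have := Nat.mul_le_mul hV hV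
    omega
  obtain ⟨γ⟩ := Function.Embedding.nonempty_of_card_le hE
  let φ : Sym2 V → Fin (2 * t) → K := fun e i => γ e ^ (i : ℕ)
  have hφ : IsSparseInjective φ t := isSparseInjective_momentCurve γ.injective t
  have hW : ∀ w : Fin (2 * t) → K, w + w = 0 := fun w => funext fun i =>
    CharTwo.add_self_eq_zero (w i)
  have hs : Fintype.card (SimpleGraph (Fin n)) < 2 ^ 2 ^ (2 * l + 1) := by
    refine (card_simpleGraph_fin_le n).trans_lt (Nat.pow_lt_pow_right (by norm_num) ?_)
    have := Nat.mul_le_mul hn hn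
    have h2 : 0 < 2 ^ l * 2 ^ l := by positivity
    rw [pow_succ, two_mul, pow_add]
    omega
  obtain ⟨g, hg⟩ := exists_seeds
    (fun (G : SimpleGraph (Fin n)) (ω : Fin (l + 1) → Fin t → Sym2 V → Bool) =>
      ¬ GoodRanks (l + 1) t t (phaseRanks ω) (Φ G))
    (fun G => unifProb_not_goodRanks_le_of_card_le hV (Φ G)) hs
  -- The seed, and a field element of `2 * l + 1` bits for each phase, rank, vertex and moment: the
  -- count in `sketchLength`.
  let M := (Fin (2 * l + 1 + 3) → Bool) × (Fin (l + 1) → Fin t → V → Fin (2 * t) → K)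
  have hM : Fintype.card M ≤ 2 ^ sketchLength (Fintype.card V) l := by
    apply le_of_eq
    simp only [M, Fintype.card_prod, Fintype.card_fun, Fintype.card_fin, Fintype.card_bool, hK,
      sketchLength, ← pow_mul]
    rw [← pow_add]
  obtain ⟨enc, henc, hlen⟩ := exists_encoding hM
  let sk : (Fin (2 * l + 1 + 3) → Bool) → SimpleGraph (Fin n) →
      Fin (l + 1) → Fin t → V → Fin (2 * t) → K :=
    fun r G i j v => vertexSketch φ (phaseRanks (g r) i) (Φ G) j v
  have hsk : ∀ r A B, sk r (A ∆ B) = sk r A + sk r B := by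
    intro r A B
    funext i j v
    simp only [sk, hΦ, Pi.add_apply]
    exact vertexSketch_symmDiff hW _ _ _ _ _ _
  -- Bob looks for any `A'` consistent with the message, with good ranks and value true. If the
  -- ranks are good for `A ∆ B` as well, linearity gives `A' ∆ B` the same sketch, hence the same
  -- components and value.
  refine ⟨⟨2 * l + 1 + 3, fun A r => enc (r, sk r A), fun B m => decide (∃ A r,
    enc (r, sk r A) = m ∧ GoodRanks (l + 1) t t (phaseRanks (g r)) (Φ (A ∆ B)) ∧
      F (A ∆ B) = true)⟩, ?_, ?_⟩
  · intro A B
    refine le_trans ?_ (hg (A ∆ B))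
    rw [coinProb_eq_unifProb, coinProb_eq_unifProb]
    refine unifProb_mono fun r hr hgood => hr ?_
    rw [Bool.eq_iff_iff, decide_eq_true_iff]
    constructor
    · rintro ⟨A', r', hm, hgood', hF'⟩
      obtain ⟨rfl, hAA'⟩ := Prod.mk.inj (henc hm)
      rw [← hF']
      refine hF _ _ fun u v => reachable_iff_of_vertexSketch_eq hW
        (T := l + 1) ?_ hφ hgood hgood' ?_ u v
      · exact hV.trans_lt (Nat.pow_lt_pow_right (by norm_num) (by omega))
      · intro i hi j hj v
        have h1 : sk r' (A ∆ B) = sk r' (A' ∆ B) := by rw [hsk, hsk, hAA']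
        exact congrFun (congrFun (congrFun h1 ⟨i, hi⟩) ⟨j, hj⟩) v
    · intro hF'
      exact ⟨A, r, rfl, hgood, hF'⟩
  · exact Finset.sup_le fun p _ => (hlen _).le

/-! ### Bipartiteness and the double cover -/

namespace SimpleGraph

/-- The bipartite double cover of a graph. -/
def doubleCover {V : Type*} (G : SimpleGraph V) : SimpleGraph (V × Bool) where
  Adj p q := G.Adj p.1 q.1 ∧ p.2 ≠ q.2
  symm := ⟨fun _ _ h => ⟨h.1.symm, h.2.symm⟩⟩
  loopless := ⟨fun _ h => h.2 rfl⟩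

theorem doubleCover_symmDiff {V : Type*} (A B : SimpleGraph V) :
    (A ∆ B).doubleCover = A.doubleCover ∆ B.doubleCover := by
  ext p q
  rw [symmDiff_adj_iff]
  simp only [doubleCover, symmDiff_adj_iff]
  tauto

theorem exists_reachable_doubleCover {V : Type*} {G : SimpleGraph V} {u v : V} (p : G.Walk u v)
    (a : Bool) : ∃ b, G.doubleCover.Reachable (u, a) (v, b) := by
  induction p generalizing a with
  | nil => exact ⟨a, Reachable.refl _⟩
  | @cons u w v h _ ih =>
    obtain ⟨b, hb⟩ := ih (!a)
    have hadj : G.doubleCover.Adj (u, a) (w, !a) := ⟨h, by simp⟩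
    exact ⟨b, hadj.reachable.trans hb⟩

/-- A walk in the cover is a walk in `G` with its parity recorded, so the lifts of `v` are joined
exactly by odd closed walks. This makes bipartiteness a function of components. -/
theorem isBipartite_iff_doubleCover {V : Type*} (G : SimpleGraph V) :
    G.IsBipartite ↔ ∀ v, ¬ G.doubleCover.Reachable (v, false) (v, true) := by
  classical
  constructor
  · rintro ⟨c⟩ v ⟨p⟩
    have hinv : ∀ x y, G.doubleCover.Walk x y →
        ((c x.1 = 0 ↔ x.2 = true) ↔ (c y.1 = 0 ↔ y.2 = true)) := by
      intro x y p
      induction p with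
      | nil => rfl
      | @cons x y z h _ ih =>
        rw [← ih]
        have h1 := c.valid h.1
        have h2 : x.2 = !y.2 := Bool.eq_not.mpr h.2
        have h3 : c x.1 = 0 ↔ ¬ c y.1 = 0 := by omega
        rw [h2, h3]
        cases y.2 <;> simp
    have := hinv _ _ p
    simp at this
  · intro h
    let root : V → V := fun v => (G.connectedComponentMk v).out
    have hroot : ∀ v, G.Reachable (root v) v := fun v =>
      ConnectedComponent.exact (Quot.out_eq (G.connectedComponentMk v))
    -- Colour by the parity of walks from a root of the component, which is well defined as no two
    -- lifts are joined.
    refine ⟨Coloring.mk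
      (fun v => if G.doubleCover.Reachable (root v, false) (v, true) then (0 : Fin 2) else 1) ?_⟩
    intro u v huv
    have hr : root u = root v := by
      simp only [root]
      rw [ConnectedComponent.sound huv.reachable]
    have hadj : ∀ a, G.doubleCover.Adj (u, a) (v, !a) := fun a => ⟨huv, by simp⟩
    have key : G.doubleCover.Reachable (root u, false) (u, true) ↔
        ¬ G.doubleCover.Reachable (root v, false) (v, true) := by
      constructor
      · intro h1 h2
        rw [← hr] at h2
        exact h v (((hadj true).symm.reachable.trans h1.symm).trans h2)
      · intro h2
        obtain ⟨p⟩ := hroot u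
        obtain ⟨b, hb⟩ := exists_reachable_doubleCover p false
        cases b with
        | true => exact hb
        | false =>
          rw [← hr] at h2
          exact absurd (hb.trans (hadj false).reachable) h2
    by_cases h1 : G.doubleCover.Reachable (root v, false) (v, true)
    · simp [key, h1]
    · simp [key, h1]

end SimpleGraph

/-! ### One-way complexity of the two graph problems -/

theorem exists_oneWayProtocol_graphProblem (f : GraphProblem) (hf : f = xorConn ∨ f = xorBip)
    {n l : ℕ} (hn : 2 * n ≤ 2 ^ l) :
    ∃ P : OneWayProtocol (SimpleGraph (Fin n)) (SimpleGraph (Fin n)),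
      P.Solves (f n) ∧ P.cost ≤ sketchLength (2 * n) l := by
  classical
  rcases hf with rfl | rfl
  · obtain ⟨P, hP, hc⟩ := exists_oneWayProtocol (n := n) (l := l) (V := Fin n)
      (by rw [Fintype.card_fin]; omega) (by omega) (fun G => decide G.Connected) id
      (fun _ _ => rfl) (fun G G' h => by
        simp only [id] at h
        simp only [SimpleGraph.connected_iff, SimpleGraph.Preconnected, h])
    refine ⟨P, ?_, hc.trans ?_⟩
    · intro A B
      convert hP A B using 4
      simp only [xorConn]
    · rw [Fintype.card_fin]
      unfold sketchLength
      gcongr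
      omega
  · obtain ⟨P, hP, hc⟩ := exists_oneWayProtocol (n := n) (l := l) (V := Fin n × Bool)
      (by simpa [mul_comm] using hn) (by omega) (fun G => decide G.IsBipartite)
      SimpleGraph.doubleCover SimpleGraph.doubleCover_symmDiff (fun G G' h => by
        simp only [SimpleGraph.isBipartite_iff_doubleCover, h])
    refine ⟨P, ?_, hc.trans ?_⟩
    · intro A B
      convert hP A B using 4
      simp only [xorBip]
    · simp [mul_comm]

theorem oneWayComplexity_le (f : GraphProblem) (hf : f = xorConn ∨ f = xorBip) {n l : ℕ}
    (hn : 2 * n ≤ 2 ^ l) : oneWayComplexity (f n) ≤ sketchLength (2 * n) l := by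
  obtain ⟨P, hP, hc⟩ := exists_oneWayProtocol_graphProblem f hf hn
  exact le_trans (Nat.sInf_le (m := P.cost) ⟨P, hP, rfl⟩) hc

theorem exists_oneWayProtocol_cost_eq (f : GraphProblem) (hf : f = xorConn ∨ f = xorBip) (n : ℕ) :
    ∃ P : OneWayProtocol (SimpleGraph (Fin n)) (SimpleGraph (Fin n)),
      P.Solves (f n) ∧ P.cost = oneWayComplexity (f n) := by
  -- The infimum of an empty set would be 0, so some protocol must exist; its cost is irrelevant,
  -- hence the crude `l`.
  obtain ⟨P, hP, -⟩ := exists_oneWayProtocol_graphProblem f hf (n := n) (l := 2 * n)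
    Nat.lt_two_pow_self.le
  exact Nat.sInf_mem (s := {c | ∃ P : OneWayProtocol (SimpleGraph (Fin n)) (SimpleGraph (Fin n)),
    P.Solves (f n) ∧ P.cost = c}) ⟨_, P, hP, rfl⟩

/-! ### Lower bounds on total cost and on one-way complexity -/

/-- A one-way protocol as an online Merlin-Arthur protocol in which Merlin is silent. -/
def OneWayProtocol.toOMA {X Y : Type} (P : OneWayProtocol X Y) : OMAProtocol X Y where
  coins := P.coins
  help _ _ := []
  msg := P.msg
  out y _ a _ := some (P.out y a)

theorem OneWayProtocol.toOMA_solves {X Y : Type} (P : OneWayProtocol X Y) {f : X → Y → Bool}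
    (hP : P.Solves f) : P.toOMA.Solves f := by
  refine ⟨fun x y h => ?_, fun x y h H => ?_⟩
  · have := hP x y
    rw [h] at this
    simpa [OneWayProtocol.toOMA] using this
  · have := hP x y
    rw [h] at this
    simpa [OneWayProtocol.toOMA] using this

theorem OneWayProtocol.toOMA_hcost {X Y : Type} [Fintype X] [Fintype Y]
    (P : OneWayProtocol X Y) : P.toOMA.hcost = 0 :=
  Nat.le_zero.mp (Finset.sup_le fun _ _ => le_rfl)

theorem le_tcost (f : GraphProblem) (hf : f = xorConn ∨ f = xorBip) {n : ℕ}
    (hn : 8 ≤ n) (P : OMAProtocol (SimpleGraph (Fin n)) (SimpleGraph (Fin n)))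
    (hP : P.Solves (f n)) : 1 / 20000 * (n : ℝ) ≤ P.tcost := by
  have h1 := sq_le_hcost_add_mul_vcost f hf hn P hP
  have hn' : (8 : ℝ) ≤ n := by exact_mod_cast hn
  have hh : (0 : ℝ) ≤ P.hcost := Nat.cast_nonneg _
  have hv : (0 : ℝ) ≤ P.vcost := Nat.cast_nonneg _
  rw [OMAProtocol.tcost]
  push_cast
  by_contra! hc
  -- A total cost this small makes `hcost` at most `n`, so the trade-off alone forces `vcost ≥ n /
  -- 20000`.
  have h2 : ((P.hcost : ℝ) + n) * P.vcost ≤ (2 * n) * P.vcost :=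
    mul_le_mul_of_nonneg_right (by linarith) hv
  nlinarith

theorem le_oneWayComplexity (f : GraphProblem) (hf : f = xorConn ∨ f = xorBip) {n : ℕ}
    (hn : 8 ≤ n) : 1 / 10000 * (n : ℝ) ≤ oneWayComplexity (f n) := by
  obtain ⟨P, hP, hc⟩ := exists_oneWayProtocol_cost_eq f hf n
  have h1 := sq_le_hcost_add_mul_vcost f hf hn P.toOMA (P.toOMA_solves hP)
  have h2 : P.toOMA.vcost = P.cost := rfl
  have hn' : (0 : ℝ) < n := by
    have : 0 < n := by omega
    exact_mod_cast this
  rw [P.toOMA_hcost, h2, hc, Nat.cast_zero, zero_add] at h1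
  refine le_of_mul_le_mul_left ?_ hn'
  linarith

/-- The four logarithms come from the phases, the ranks, the moments and the bits of a field
element. -/
theorem oneWayComplexity_le_logb_pow (f : GraphProblem) (hf : f = xorConn ∨ f = xorBip) {n : ℕ}
    (hn : 4 ≤ n) :
    (oneWayComplexity (f n) : ℝ) ≤ 6000 * n * Real.logb 2 ((n ^ 2 : ℕ) : ℝ) ^ 4 := by
  have hle : 2 * n ≤ 2 ^ (Nat.log 2 n + 2) := by
    have := Nat.lt_pow_succ_log_self (b := 2) (by norm_num) n
    rw [pow_succ _ (Nat.log 2 n + 1), Nat.succ_eq_add_one] at *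
    omega
  have h1 := oneWayComplexity_le f hf hle
  obtain ⟨l, hl⟩ : ∃ l, l = Nat.log 2 n + 2 := ⟨_, rfl⟩
  rw [← hl] at h1
  have hl1 : 1 ≤ l := by omega
  -- The input size `n ^ 2` doubles the logarithm, which absorbs the `+ 2` in `l` once `n ≥ 4`.
  have hlog : (l : ℝ) ≤ Real.logb 2 ((n ^ 2 : ℕ) : ℝ) := by
    have h2 : ((Nat.log 2 n : ℕ) : ℝ) ≤ Real.logb 2 n := by
      exact_mod_cast Real.natLog_le_logb n 2
    have h3 : (2 : ℝ) ≤ Real.logb 2 n := by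
      rw [Real.le_logb_iff_rpow_le (by norm_num) (by exact_mod_cast (by omega : 0 < n))]
      norm_num
      exact hn
    rw [hl]
    push_cast
    rw [Real.logb_pow]
    push_cast
    linarith
  have h4 : sketchLength (2 * n) l ≤ 6000 * n * l ^ 4 := by
    unfold sketchLength
    have hl4 : l ≤ l ^ 4 := Nat.le_self_pow (by norm_num) l
    calc (2 * l + 4) + (2 * l + 1) * (2 * (5 * l + 10)) * (2 * n) * (5 * l + 10) * (l + 1)
        ≤ (6 * l) + (3 * l) * (2 * (15 * l)) * (2 * n) * (15 * l) * (2 * l) := by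
          gcongr <;> omega
      _ = 6 * l + 5400 * n * l ^ 4 := by ring
      _ ≤ 6 * (n * l ^ 4) + 5400 * n * l ^ 4 := by
          have : l ≤ n * l ^ 4 := hl4.trans (Nat.le_mul_of_pos_left _ (by omega))
          omega
      _ ≤ 6000 * n * l ^ 4 := by
          have : 0 ≤ n * l ^ 4 := Nat.zero_le _
          nlinarith
  calc (oneWayComplexity (f n) : ℝ) ≤ ((6000 * n * l ^ 4 : ℕ) : ℝ) := by
        exact_mod_cast h1.trans h4
    _ = 6000 * n * (l : ℝ) ^ 4 := by push_cast; ring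
    _ ≤ 6000 * n * Real.logb 2 ((n ^ 2 : ℕ) : ℝ) ^ 4 := by gcongr

theorem corollary5 (f : GraphProblem) (hf : f = xorConn ∨ f = xorBip) :
    (∃ c : ℝ, 0 < c ∧ ∀ᶠ n : ℕ in atTop,
      ∀ P : OMAProtocol (SimpleGraph (Fin n)) (SimpleGraph (Fin n)), P.Solves (f n) →
        c * (n : ℝ) ^ 2 ≤ ((P.hcost : ℝ) + n) * (P.vcost : ℝ)) ∧
    (∀ (h v : ℕ → ℝ), (∀ n, 0 ≤ h n) → (∀ n, 0 ≤ v n) →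
      ∀ P : ∀ n : ℕ, OMAProtocol (SimpleGraph (Fin n)) (SimpleGraph (Fin n)),
        IsOMAProtocolFor f P h v →
          (fun n : ℕ => (n : ℝ) ^ 2) =O[atTop] fun n => (h n + n) * v n) ∧
    NontrivialOMAComplexityOmega f (fun n => (n : ℝ)) ∧
    NontrivialOMAComplexityOmegaTilde (fun n => n ^ 2) f
      (fun n => (oneWayComplexity (f n) : ℝ)) ∧
    (fun n : ℕ => (n : ℝ)) =O[atTop] (fun n => (oneWayComplexity (f n) : ℝ)) := by
  refine ⟨⟨1 / 10000, by norm_num, ?_⟩, ?_, ⟨1 / 20000, by norm_num, ?_⟩,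
    ⟨4, 1 / 20000 / 6000, by norm_num, ?_⟩, ?_⟩
  · filter_upwards [eventually_ge_atTop 8] with n hn P hP
    exact sq_le_hcost_add_mul_vcost f hf hn P hP
  · rintro h v hh hv P ⟨hP, hhc, hvc⟩
    obtain ⟨a, ha, hhc⟩ := hhc.exists_pos
    obtain ⟨b, hb, hvc⟩ := hvc.exists_pos
    refine IsBigO.of_bound (10000 * ((a + 1) * b)) ?_
    filter_upwards [eventually_ge_atTop 8, hhc.bound, hvc.bound] with n hn h1 h2
    have h3 := sq_le_hcost_add_mul_vcost f hf hn (P n) (hP n)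
    have hhn := hh n
    have hvn := hv n
    have hn0 : (0 : ℝ) ≤ n := Nat.cast_nonneg n
    rw [Real.norm_of_nonneg (by positivity), Real.norm_of_nonneg (by positivity)] at h1 h2
    rw [Real.norm_of_nonneg (by positivity), Real.norm_of_nonneg (by positivity)]
    have h4 : ((P n).hcost : ℝ) + n ≤ (a + 1) * (h n + n) := by nlinarith
    have h5 : (((P n).hcost : ℝ) + n) * ((P n).vcost : ℝ) ≤ ((a + 1) * (h n + n)) * (b * v n) :=
      mul_le_mul h4 h2 (by positivity) (by positivity)
    linarith
  · rintro P ⟨hP, -⟩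
    filter_upwards [eventually_ge_atTop 8] with n hn
    exact le_tcost f hf hn (P n) (hP n)
  · rintro P ⟨hP, -⟩
    filter_upwards [eventually_ge_atTop 8] with n hn
    have h1 := le_tcost f hf hn (P n) (hP n)
    have h2 := oneWayComplexity_le_logb_pow f hf (by omega : 4 ≤ n)
    have h3 : 0 ≤ Real.logb 2 ((n ^ 2 : ℕ) : ℝ) ^ 4 := by positivity
    nlinarith [mul_le_mul_of_nonneg_left h1 h3]
  · refine IsBigO.of_bound 10000 ?_
    filter_upwards [eventually_ge_atTop 8] with n hn
    have h1 := le_oneWayComplexity f hf hn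
    rw [Real.norm_of_nonneg (by positivity), Real.norm_of_nonneg (by positivity)]
    linarith
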